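/- Let $d\ge 1$, let $\mathcal H_s=\ell^2(\{0,\dots,d-1\})$ and $\mathcal H_r=\ell^2(\mathbb Z)$ with canonical bases $(e_j)$ and $(\Psi_j)$, and let $a^{\#}_j=a^\#(e_j)$, $b^{\#}_j=b^\#(\Psi_j)$ be the fermionic creation and annihilation operators on the antisymmetric Fock spaces $\mathcal F_-(\mathcal H_s)$ and $\mathcal F_-(\mathcal H_r)$; let $\mathcal B$ be the $C^*$-algebra generated by the operators $b(\phi)$, $\phi\in\mathcal H_r$. Let $W$ be an arbitrary unitary operator on $\mathcal H_s$, let $S\Psi_j=\Psi_{j-1}$ be the shift on $\mathcal H_r$, let $\alpha\in\mathbb R$, and define on $\mathcal F_-(\mathcal H_r)\otimes\mathcal F_-(\mathcal H_s)$ the unitary operator $$U=\bigl(\Gamma(S)\otimes\Gamma(W)\bigr)\,e^{-i\alpha(b_0^*\otimes a_0+b_0\otimes a_0^*)},$$ where $\Gamma$ denotes second quantization, and $\tau^t(X)=U^{*t}XU^t$. Let $0\le\sigma\le1$ and let $\omega$ be the gauge-invariant quasi-free state on $\mathcal B$ with density $\Sigma=\sigma\mathbb I$, i.e. $\omega(b^*(\phi_m)\cdots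 b^*(\phi_1)b(\psi_1)\cdots b(\psi_n))=\delta_{nm}\det\bigl(\langle\psi_j|\Sigma\phi_k\rangle\bigr)$. Let $\rho$ be an arbitrary density matrix on $\mathcal F_-(\mathcal H_s)$, with one-body reduced density matrix $\rho^{(1)}$, $\langle e_j|\rho^{(1)}e_k\rangle=\operatorname{tr}(\rho\,a_k^*a_j)$. For $t\in\mathbb N$ let $\rho_t(A)=(\omega\otimes\rho)(\tau^t(\mathbb I\otimes A))$ and let $\rho^{(1)}_t$ be the $d\times d$ matrix with $\langle e_j|\rho_t^{(1)}e_k\rangle=\rho_t(a_k^*a_j)$. Identify $W$ with its matrix in the basis $(e_j)$ and set $$\mathbb M=W\bigl(\mathbb I+(\cos\alpha-1)|e_0\rangle\langle e_0|\bigr),\qquad \mathbb B=W\bigl(\sigma\sin^2(\alpha)\,|e_0\rangle\langle e_0|\bigr)W^*,\qquad \mathcal M(A)=\mathbb M A\mathbb M^*\quad(A\in M_d(\mathbb C)).$$ Assume that the spectrum of $\mathcal M$ does not meet the unit circle $\{z\in\mathbb C:|z|=1\}$. Then $1-\mathcal M$ is invertible; for all $t\in\mathbb N$, $$\rho^{(1)}_t=\mathcal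 M^t\bigl(\rho^{(1)}-(1-\mathcal M)^{-1}(\mathbb B)\bigr)+(1-\mathcal M)^{-1}(\mathbb B);$$ and $$\lim_{t\to\infty}\rho^{(1)}_t=(1-\mathcal M)^{-1}(\mathbb B)=\sigma\,\mathbb I .$$ In particular the limit does not depend on $W$, on $\alpha$ or on $\rho$. -/

import Mathlib

open scoped Matrix TensorProduct ComplexOrder

noncomputable section

namespace FermiSample

/-! ### One-particle spaces and antisymmetric Fock spaces -/

/-- The Hilbert space `ℓ²(ι)`. -/
abbrev L2 (ι : Type*) : Type _ := lp (fun _ : ι => ℂ) 2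

/-- The canonical basis vector of `ℓ²(ι)` at `i`. -/
def basisVec {ι : Type*} (i : ι) : L2 ι :=
  open scoped Classical in lp.single 2 i (1 : ℂ)

/-- The antisymmetric Fock space over `ℓ²(ι)`, `ι` linearly ordered, in the occupation number
representation: the canonical basis vector at the finite set `S = {j₁ < ⋯ < j_q}` is the
normalized vector `e_{j₁} ∧ ⋯ ∧ e_{j_q}`. -/
abbrev Fock (ι : Type*) : Type _ := L2 (Finset ι)

/-- The algebra of bounded operators on a normed space. -/
abbrev Op (E : Type*) [NormedAddCommGroup E] [NormedSpace ℂ E] : Type _ := E →L[ℂ] E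

section WeightedComposition

variable {κ : Type*}

lemma wcomp_sum_le (u : κ → ℂ) (f : κ → κ) (hu : ∀ a, ‖u a‖ ≤ 1)
    (hf : Set.InjOn f {a | u a ≠ 0}) (ψ : L2 κ) (s : Finset κ) :
    ∑ a ∈ s, ‖u a * ψ (f a)‖ ^ (2 : ENNReal).toReal ≤ ‖ψ‖ ^ (2 : ENNReal).toReal := by
  classical
  have h1 : ∑ a ∈ s, ‖u a * ψ (f a)‖ ^ (2 : ENNReal).toReal
      ≤ ∑ a ∈ s with u a ≠ 0, ‖ψ (f a)‖ ^ (2 : ENNReal).toReal := by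
    rw [Finset.sum_filter]
    refine Finset.sum_le_sum fun a _ => ?_
    split_ifs with h
    · rw [norm_mul]
      refine Real.rpow_le_rpow (by positivity) ?_ (by simp)
      exact mul_le_of_le_one_left (norm_nonneg _) (hu a)
    · have h0 : u a = 0 := by simpa using h
      simp [h0]
  refine h1.trans ?_
  rw [← Finset.sum_image (s := s.filter fun a => u a ≠ 0) (g := f)
    (f := fun b => ‖ψ b‖ ^ (2 : ENNReal).toReal)]
  · exact lp.sum_rpow_le_norm_rpow (by simp) ψ _
  · intro a ha b hb hab
    exact hf (by simpa using (Finset.mem_filter.1 ha).2) (by simpa using (Finset.mem_filter.1 hb).2)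
      hab

/-- The bounded operator `(T ψ)(a) = u(a) ψ(f(a))` on `ℓ²(κ)`, for bounded weights `u` and a map
`f` which is injective where `u` does not vanish. -/
def wcomp (u : κ → ℂ) (f : κ → κ) (hu : ∀ a, ‖u a‖ ≤ 1)
    (hf : Set.InjOn f {a | u a ≠ 0}) : Op (L2 κ) :=
  LinearMap.mkContinuous
    { toFun := fun ψ => ⟨fun a => u a * ψ (f a), memℓp_gen' (wcomp_sum_le u f hu hf ψ)⟩
      map_add' := fun ψ χ => by
        ext a
        exact mul_add (u a) (ψ (f a)) (χ (f a))
      map_smul' := fun c ψ => by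
        ext a
        exact mul_left_comm (u a) c (ψ (f a)) }
    1 (fun ψ => by
      rw [one_mul]
      exact lp.norm_le_of_forall_sum_le (by simp) (norm_nonneg _) (wcomp_sum_le u f hu hf ψ))

lemma wcomp_apply (u : κ → ℂ) (f : κ → κ) (hu : ∀ a, ‖u a‖ ≤ 1)
    (hf : Set.InjOn f {a | u a ≠ 0}) (ψ : L2 κ) (a : κ) :
    wcomp u f hu hf ψ a = u a * ψ (f a) := rfl

end WeightedComposition

section Fock

variable {ι : Type*} [LinearOrder ι]

/-- The sign `(-1)^{#{i ∈ S : i < j}}`. -/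
def jwSign (j : ι) (S : Finset ι) : ℂ := (-1) ^ (S.filter (· < j)).card

lemma norm_jwSign (j : ι) (S : Finset ι) : ‖jwSign j S‖ = 1 := by simp [jwSign]

lemma jwSign_mul_self (j : ι) (S : Finset ι) : jwSign j S * jwSign j S = 1 := by
  rw [jwSign, ← mul_pow]; simp

lemma conj_jwSign (j : ι) (S : Finset ι) : starRingEnd ℂ (jwSign j S) = jwSign j S := by
  simp [jwSign]

/-- The annihilation operator `c_j`: it sends the basis vector at `S ∋ j` to
`(-1)^{#{i ∈ S : i < j}}` times the basis vector at `S \ {j}`, and the basis vector at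
`S ∌ j` to zero. -/
def siteAnnih (j : ι) : Op (Fock ι) :=
  wcomp (fun S => if j ∈ S then 0 else jwSign j S) (fun S => insert j S)
    (fun S => by split_ifs <;> simp [norm_jwSign])
    (by
      intro S hS T hT h
      have hS' : j ∉ S := fun h' => hS (by simp [h'])
      have hT' : j ∉ T := fun h' => hT (by simp [h'])
      have := congrArg (fun X => Finset.erase X j) h
      simpa [Finset.erase_insert hS', Finset.erase_insert hT'] using this)

/-- The creation operator `c_j^*`. -/
def siteCreate (j : ι) : Op (Fock ι) := ContinuousLinearMap.adjoint (siteAnnih j)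

lemma siteAnnih_apply (j : ι) (ψ : Fock ι) (S : Finset ι) :
    siteAnnih j ψ S = if j ∈ S then 0 else jwSign j S * ψ (insert j S) := by
  refine (wcomp_apply _ _ _ _ ψ S).trans ?_
  split_ifs <;> simp

lemma basisVec_apply {κ : Type*} [DecidableEq κ] (i j : κ) :
    (basisVec i : L2 κ) j = if j = i then 1 else 0 := by
  classical
  simp [basisVec, lp.single_apply, Pi.single_apply]

lemma inner_basisVec {κ : Type*} (i : κ) (ψ : L2 κ) : inner ℂ (basisVec i) ψ = ψ i := by
  classical
  simp [basisVec, lp.inner_single_left]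

lemma siteAnnih_basisVec (j : ι) (S : Finset ι) :
    siteAnnih j (basisVec S) = if j ∈ S then jwSign j S • basisVec (S.erase j) else 0 := by
  ext T
  rw [siteAnnih_apply]
  by_cases hS : j ∈ S
  · by_cases hT : j ∈ T
    · have : T ≠ S.erase j := by rintro rfl; simp at hT
      simp [hS, hT, basisVec_apply, this]
    · simp only [hT, hS, if_true, if_false, basisVec_apply, lp.coeFn_smul, Pi.smul_apply,
        smul_eq_mul]
      by_cases h : T = S.erase j
      · subst h
        have : (S.erase j).filter (· < j) = S.filter (· < j) := by
          ext i; simp only [Finset.mem_filter, Finset.mem_erase]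
          constructor
          · rintro ⟨⟨_, h⟩, h'⟩; exact ⟨h, h'⟩
          · rintro ⟨h, h'⟩; exact ⟨⟨h'.ne, h⟩, h'⟩
        simp [Finset.insert_erase hS, jwSign, this]
      · have : insert j T ≠ S := by
          rintro rfl; exact h (by simp [Finset.erase_insert hT])
        simp [h, this]
  · by_cases hT : j ∈ T
    · simp [hS, hT]
    · have : insert j T ≠ S := by rintro rfl; simp at hS
      simp [hS, hT, basisVec_apply, this]

lemma siteCreate_apply (j : ι) (ψ : Fock ι) (S : Finset ι) :
    siteCreate j ψ S = if j ∈ S then jwSign j S * ψ (S.erase j) else 0 := by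
  rw [← inner_basisVec, siteCreate, ContinuousLinearMap.adjoint_inner_right, siteAnnih_basisVec]
  split_ifs
  · rw [inner_smul_left, conj_jwSign, inner_basisVec]
  · simp

lemma jwSign_insert {j k : ι} (S : Finset ι) (hk : k ∉ S) :
    jwSign j (insert k S) = (if k < j then -1 else 1) * jwSign j S := by
  simp only [jwSign, Finset.filter_insert]
  split_ifs with h
  · rw [Finset.card_insert_of_notMem (by simp [hk]), pow_succ]; ring
  · simp

lemma jwSign_erase {j k : ι} (S : Finset ι) (hk : k ∈ S) :
    jwSign j (S.erase k) = (if k < j then -1 else 1) * jwSign j S := by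
  conv_rhs => rw [← Finset.insert_erase hk, jwSign_insert _ (Finset.notMem_erase k S)]
  split_ifs <;> simp

/-- The canonical anticommutation relation `{c_j, c_k^*} = δ_{jk}`. -/
lemma site_car (j k : ι) :
    siteAnnih j * siteCreate k + siteCreate k * siteAnnih j
      = if j = k then (1 : Op (Fock ι)) else 0 := by
  ext ψ S
  have hl : (siteAnnih j * siteCreate k + siteCreate k * siteAnnih j) ψ S
      = siteAnnih j (siteCreate k ψ) S + siteCreate k (siteAnnih j ψ) S := rfl
  rw [hl, siteAnnih_apply, siteCreate_apply, siteCreate_apply, siteAnnih_apply]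
  by_cases hjk : j = k
  · subst hjk
    by_cases hj : j ∈ S
    · simp [hj, jwSign_erase S hj, ← mul_assoc, jwSign_mul_self]
    · simp [hj, jwSign_insert S hj, ← mul_assoc, jwSign_mul_self]
  · have hkj : ¬ k = j := fun h => hjk h.symm
    by_cases hj : j ∈ S
    · simp [hj, hjk]
    · by_cases hk : k ∈ S
      · have hjS : j ∉ S.erase k := by simp [hj]
        have hE : (insert j S).erase k = insert j (S.erase k) := by
          rw [Finset.erase_insert_of_ne hjk]
        simp only [hj, hk, hjk, hjS, if_true, if_false, Finset.mem_insert, hkj, false_or, hE,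
          jwSign_insert S hj, jwSign_erase S hk]
        rcases lt_or_gt_of_ne hjk with h | h
        · simp [h, not_lt.2 h.le]; ring
        · simp [h, not_lt.2 h.le]; ring
      · simp [hj, hk, hjk, hkj]

lemma norm_sum_smul_siteCreate_sq_le (φ : ι → ℂ) (s : Finset ι) :
    ‖∑ j ∈ s, φ j • siteCreate j‖ ^ 2 ≤ ∑ j ∈ s, ‖φ j‖ ^ 2 := by
  set A : Op (Fock ι) := ∑ j ∈ s, φ j • siteCreate j with hA
  have hA' : star A = ∑ j ∈ s, starRingEnd ℂ (φ j) • siteAnnih j := by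
    simp only [hA, star_sum, star_smul]
    refine Finset.sum_congr rfl fun j _ => ?_
    rw [siteCreate, ContinuousLinearMap.star_eq_adjoint, ContinuousLinearMap.adjoint_adjoint]
    rfl
  have hcar : star A * A + A * star A = ((∑ j ∈ s, ‖φ j‖ ^ 2 : ℝ) : ℂ) • (1 : Op (Fock ι)) := by
    rw [hA', hA, Finset.sum_mul_sum, Finset.sum_mul_sum, Finset.sum_comm, ← Finset.sum_add_distrib]
    push_cast
    rw [Finset.sum_smul]
    refine Finset.sum_congr rfl fun k hk => ?_
    rw [← Finset.sum_add_distrib]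
    have h : ∀ j, (starRingEnd ℂ (φ j) • siteAnnih j) * (φ k • siteCreate k)
        + (φ k • siteCreate k) * (starRingEnd ℂ (φ j) • siteAnnih j)
        = (starRingEnd ℂ (φ j) * φ k) • (if j = k then (1 : Op (Fock ι)) else 0) := by
      intro j
      rw [← site_car, smul_add, smul_mul_smul_comm, smul_mul_smul_comm, mul_comm (φ k)]
    simp only [h]
    rw [Finset.sum_eq_single k (by intro b _ hb; simp [hb]) (by intro h'; exact absurd hk h')]
    simp only [if_true]
    rw [Complex.conj_mul']
  have hS : 0 ≤ ∑ j ∈ s, ‖φ j‖ ^ 2 := Finset.sum_nonneg fun _ _ => by positivity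
  have hbound : ‖A‖ ≤ Real.sqrt (∑ j ∈ s, ‖φ j‖ ^ 2) := by
    refine ContinuousLinearMap.opNorm_le_bound _ (Real.sqrt_nonneg _) fun ψ => ?_
    have h1 : inner ℂ ψ ((star A * A + A * star A) ψ)
        = ((‖A ψ‖ ^ 2 + ‖star A ψ‖ ^ 2 : ℝ) : ℂ) := by
      have e1 : inner ℂ ψ (star A (A ψ)) = inner ℂ (A ψ) (A ψ) :=
        ContinuousLinearMap.adjoint_inner_right A ψ (A ψ)
      have e2 : inner ℂ ψ (A (star A ψ)) = inner ℂ (star A ψ) (star A ψ) :=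
        (ContinuousLinearMap.adjoint_inner_left A (star A ψ) ψ).symm
      have e3 : (star A * A + A * star A) ψ = star A (A ψ) + A (star A ψ) := rfl
      rw [e3, inner_add_right, e1, e2, inner_self_eq_norm_sq_to_K, inner_self_eq_norm_sq_to_K]
      push_cast
      rfl
    rw [hcar] at h1
    have h2 : inner ℂ ψ ((((∑ j ∈ s, ‖φ j‖ ^ 2 : ℝ) : ℂ) • (1 : Op (Fock ι))) ψ)
        = (((∑ j ∈ s, ‖φ j‖ ^ 2) * ‖ψ‖ ^ 2 : ℝ) : ℂ) := by
      have e3 : (((∑ j ∈ s, ‖φ j‖ ^ 2 : ℝ) : ℂ) • (1 : Op (Fock ι))) ψ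
        = ((∑ j ∈ s, ‖φ j‖ ^ 2 : ℝ) : ℂ) • ψ := rfl
      rw [e3, inner_smul_right, inner_self_eq_norm_sq_to_K]
      push_cast
      rfl
    rw [h2] at h1
    have h3 : (∑ j ∈ s, ‖φ j‖ ^ 2) * ‖ψ‖ ^ 2 = ‖A ψ‖ ^ 2 + ‖star A ψ‖ ^ 2 := by exact_mod_cast h1
    refine Real.le_sqrt_of_sq_le ?_ |>.trans_eq (?_ :
      Real.sqrt ((∑ j ∈ s, ‖φ j‖ ^ 2) * ‖ψ‖ ^ 2) = _)
    · rw [h3]; nlinarith [sq_nonneg ‖star A ψ‖]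
    · rw [Real.sqrt_mul hS, Real.sqrt_sq (norm_nonneg _)]
  calc ‖A‖ ^ 2 ≤ Real.sqrt (∑ j ∈ s, ‖φ j‖ ^ 2) ^ 2 := by gcongr
    _ = _ := Real.sq_sqrt hS

lemma summable_smul_siteCreate (φ : L2 ι) : Summable fun j => φ j • siteCreate j := by
  have hφ : Summable fun j => ‖φ j‖ ^ 2 := by
    have := (lp.memℓp φ).summable (by simp)
    simpa using this
  rw [summable_iff_vanishing_norm]
  intro ε hε
  obtain ⟨s, hs⟩ := summable_iff_vanishing_norm.1 hφ (ε ^ 2) (by positivity)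
  refine ⟨s, fun t ht => ?_⟩
  have h1 := norm_sum_smul_siteCreate_sq_le (fun j => φ j) t
  have h2 := (le_abs_self _).trans_lt (hs t ht)
  exact lt_of_pow_lt_pow_left₀ 2 hε.le (h1.trans_lt h2)

/-- The creation operator `c^*(φ) = ∑_j φ_j c_j^*` (a norm convergent series). -/
def create (φ : L2 ι) : Op (Fock ι) := ∑' j, φ j • siteCreate j

/-- The annihilation operator `c(φ)`, the adjoint of `c^*(φ)`. -/
def annih (φ : L2 ι) : Op (Fock ι) := ContinuousLinearMap.adjoint (create φ)

/-- The vacuum vector. -/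
def vacuum : Fock ι := basisVec ∅

/-- `u₁ ∧ ⋯ ∧ u_q = c^*(u₁) ⋯ c^*(u_q) Ω`. -/
def wedge (l : List (L2 ι)) : Fock ι := l.foldr (fun u x => create u x) vacuum

lemma hasSum_create (φ : L2 ι) : HasSum (fun j => φ j • siteCreate j) (create φ) :=
  (summable_smul_siteCreate φ).hasSum

lemma hasSum_annih (φ : L2 ι) :
    HasSum (fun j => starRingEnd ℂ (φ j) • siteAnnih j) (annih φ) := by
  have h := (hasSum_create φ).star
  have e : (fun j => star (φ j • siteCreate j)) =
      fun j => starRingEnd ℂ (φ j) • siteAnnih (ι := ι) j := by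
    funext j
    rw [star_smul, siteCreate, ContinuousLinearMap.star_eq_adjoint,
      ContinuousLinearMap.adjoint_adjoint]
    rfl
  rw [e] at h
  exact h

/-- The canonical anticommutation relation `{c(φ), c^*(χ)} = ⟨φ, χ⟩`. -/
lemma car (φ χ : L2 ι) :
    annih φ * create χ + create χ * annih φ = inner ℂ φ χ • (1 : Op (Fock ι)) := by
  have h1 : ∀ j, siteAnnih j * create χ + create χ * siteAnnih j = χ j • (1 : Op (Fock ι)) := by
    intro j
    have a := ((hasSum_create χ).mul_left (siteAnnih j)).add
      ((hasSum_create χ).mul_right (siteAnnih j))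
    have b : HasSum (fun k => siteAnnih j * (χ k • siteCreate k)
        + χ k • siteCreate k * siteAnnih j) (χ j • (1 : Op (Fock ι))) := by
      have e : (fun k => siteAnnih j * (χ k • siteCreate k)
        + χ k • siteCreate k * siteAnnih j) = fun k => χ k • (if j = k then 1 else 0) := by
        funext k
        rw [← site_car, smul_add, mul_smul_comm, smul_mul_assoc]
      rw [e]
      convert hasSum_single j ?_ using 1
      · simp
      · intro k hk; simp [Ne.symm hk]
    exact a.unique b
  have a := ((hasSum_annih φ).mul_right (create χ)).add
      ((hasSum_annih φ).mul_left (create χ))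
  have e : (fun j => starRingEnd ℂ (φ j) • siteAnnih j * create χ
      + create χ * (starRingEnd ℂ (φ j) • siteAnnih j))
      = fun j => inner ℂ (φ j) (χ j) • (1 : Op (Fock ι)) := by
    funext j
    rw [smul_mul_assoc, mul_smul_comm, ← smul_add, h1, smul_smul, RCLike.inner_apply, mul_comm]
  rw [e] at a
  exact a.unique ((lp.hasSum_inner φ χ).smul_const _)

lemma annih_vacuum (φ : L2 ι) : annih φ vacuum = 0 := by
  have h := (hasSum_annih φ).mapL (ContinuousLinearMap.apply ℂ (Fock ι) vacuum)
  refine h.unique ?_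
  convert hasSum_zero using 2 with j
  simp [vacuum, siteAnnih_basisVec]

lemma annih_create_apply (φ χ : L2 ι) (x : Fock ι) :
    annih φ (create χ x) = inner ℂ φ χ • x - create χ (annih φ x) := by
  have h := congrArg (fun T : Op (Fock ι) => T x) (car φ χ)
  exact eq_sub_of_add_eq h

lemma annih_wedge_of_notMem {f : ι → L2 ι} (hf : Orthonormal ℂ f) (a : ι) (l : List ι)
    (ha : a ∉ l) : annih (f a) (wedge (l.map f)) = 0 := by
  induction l with
  | nil => exact annih_vacuum _
  | cons b l ih =>
    have hab : a ≠ b := fun h => ha (by simp [h])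
    have hal : a ∉ l := fun h => ha (by simp [h])
    have e : wedge ((b :: l).map f) = create (f b) (wedge (l.map f)) := rfl
    rw [e, annih_create_apply, ih hal, hf.2 hab]
    simp

lemma inner_wedge_wedge {f : ι → L2 ι} (hf : Orthonormal ℂ f) (l l' : List ι)
    (hl : l.Pairwise (· < ·)) (hl' : l'.Pairwise (· < ·)) :
    inner ℂ (wedge (l.map f)) (wedge (l'.map f)) = if l = l' then (1 : ℂ) else 0 := by
  have key : ∀ (a : ι) (l : List ι) (x : Fock ι), annih (f a) x = 0 →
      inner ℂ (wedge ((a :: l).map f)) x = 0 := by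
    intro a l x hx
    have e : wedge ((a :: l).map f) = create (f a) (wedge (l.map f)) := rfl
    rw [e, ← ContinuousLinearMap.adjoint_inner_right]
    change inner ℂ _ (annih (f a) x) = 0
    rw [hx, inner_zero_right]
  induction l generalizing l' with
  | nil =>
    cases l' with
    | nil =>
      change inner ℂ (basisVec ∅) (basisVec ∅ : Fock ι) = _
      simp only [inner_basisVec, basisVec_apply, if_true]
    | cons b l' =>
      rw [← inner_conj_symm]
      change starRingEnd ℂ (inner ℂ _ vacuum) = _
      rw [key b l' _ (annih_vacuum _)]
      simp
  | cons a l ih =>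
    cases l' with
    | nil =>
      change inner ℂ _ vacuum = _
      rw [key a l _ (annih_vacuum _)]
      simp
    | cons b l' =>
      rw [List.pairwise_cons] at hl hl'
      rcases lt_trichotomy a b with h | h | h
      · rw [key a l _ (annih_wedge_of_notMem hf a _ ?_)]
        · simp [h.ne]
        · intro hm
          rcases List.mem_cons.1 hm with h' | h'
          · exact h.ne h'
          · exact absurd (hl'.1 a h') (not_lt.2 h.le)
      · subst h
        have e : ∀ l, wedge ((a :: l).map f) = create (f a) (wedge (l.map f)) := fun _ => rfl
        rw [e, e, ← ContinuousLinearMap.adjoint_inner_right]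
        change inner ℂ _ (annih (f a) (create (f a) (wedge (l'.map f)))) = _
        rw [annih_create_apply, annih_wedge_of_notMem hf a l' (fun h => (hl'.1 a h).false),
          map_zero, sub_zero, inner_self_eq_norm_sq_to_K, hf.1 a]
        simp [ih l' hl.2 hl'.2]
      · rw [← inner_conj_symm, key b l' _ (annih_wedge_of_notMem hf b _ ?_)]
        · simp [h.ne']
        · intro hm
          rcases List.mem_cons.1 hm with h' | h'
          · exact h.ne h'
          · exact absurd (hl.1 b h') (not_lt.2 h.le)

lemma orthonormal_wedge {f : ι → L2 ι} (hf : Orthonormal ℂ f) :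
    Orthonormal ℂ fun S : Finset ι => wedge ((S.sort (· ≤ ·)).map f) := by
  rw [orthonormal_iff_ite]
  intro S T
  rw [inner_wedge_wedge hf _ _ (Finset.sortedLT_sort S).pairwise (Finset.sortedLT_sort T).pairwise]
  have : S.sort (· ≤ ·) = T.sort (· ≤ ·) ↔ S = T := by
    constructor
    · intro h
      have := congrArg List.toFinset h
      simpa using this
    · rintro rfl; rfl
  simp [this]

end Fock

/-- The linear isometry of `ℓ²(κ)` into a Hilbert space which maps the canonical basis to a given
orthonormal family. -/
def ofOrthonormal {κ : Type*} {E : Type*} [NormedAddCommGroup E] [InnerProductSpace ℂ E]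
    [CompleteSpace E] (v : κ → E) (hv : Orthonormal ℂ v) : L2 κ →ₗᵢ[ℂ] E :=
  hv.orthogonalFamily.linearIsometry

lemma ofOrthonormal_basisVec {κ : Type*} {E : Type*} [NormedAddCommGroup E]
    [InnerProductSpace ℂ E] [CompleteSpace E] (v : κ → E) (hv : Orthonormal ℂ v) (i : κ) :
    ofOrthonormal v hv (basisVec i) = v i := by
  classical
  rw [ofOrthonormal, basisVec]
  convert hv.orthogonalFamily.linearIsometry_apply_single (i := i) (1 : ℂ) using 1
  simp

lemma orthonormal_basisVec {κ : Type*} : Orthonormal ℂ (basisVec : κ → L2 κ) := by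
  classical
  rw [orthonormal_iff_ite]
  intro i j
  rw [inner_basisVec, basisVec_apply]

/-- The second quantization `Γ(u)` of an isometry `u` of `ℓ²(ι)`:
`Γ(u) (e_{j₁} ∧ ⋯ ∧ e_{j_q}) = u e_{j₁} ∧ ⋯ ∧ u e_{j_q}` for `j₁ < ⋯ < j_q`. -/
def secondQuant {ι : Type*} [LinearOrder ι] (u : L2 ι →ₗᵢ[ℂ] L2 ι) : Op (Fock ι) :=
  (ofOrthonormal (fun S : Finset ι => wedge ((S.sort (· ≤ ·)).map fun j => u (basisVec j)))
    (orthonormal_wedge (f := fun j => u (basisVec j))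
      (orthonormal_basisVec.comp_linearIsometry u))).toContinuousLinearMap

/-! ### The tensor product with a finite dimensional Hilbert space -/

/-- The Hilbert space tensor product `E ⊗ G` needs no completion when `G` has finite dimension. -/
instance instCompleteSpaceTensor {E G : Type*} [NormedAddCommGroup E] [InnerProductSpace ℂ E]
    [CompleteSpace E] [NormedAddCommGroup G] [InnerProductSpace ℂ G] [FiniteDimensional ℂ G] :
    CompleteSpace (E ⊗[ℂ] G) := by
  let g := stdOrthonormalBasis ℂ G
  let fwd : (Fin (Module.finrank ℂ G) → E) →L[ℂ] E ⊗[ℂ] G :=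
    ∑ i, ((TensorProduct.mkL ℂ E G).flip (g i)).comp (ContinuousLinearMap.proj i)
  let bwd : E ⊗[ℂ] G →L[ℂ] (Fin (Module.finrank ℂ G) → E) :=
    ContinuousLinearMap.pi fun i =>
      (TensorProduct.ridIsometry ℂ E).toContinuousLinearEquiv.toContinuousLinearMap.comp
        (ContinuousLinearMap.lTensor E (innerSL ℂ (g i)))
  have h1 : ∀ x, fwd (bwd x) = x := by
    intro x
    induction x using TensorProduct.induction_on with
    | zero => simp
    | add x y hx hy => rw [map_add, map_add, hx, hy]
    | tmul a b =>
      have e : fwd (bwd (a ⊗ₜ b)) = ∑ i, (inner ℂ (g i) b • a) ⊗ₜ[ℂ] g i := by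
        simp [fwd, bwd, TensorProduct.smul_tmul']
      rw [e]
      conv_rhs => rw [← g.sum_repr' b]
      rw [TensorProduct.tmul_sum]
      exact Finset.sum_congr rfl fun i _ => TensorProduct.smul_tmul _ _ _
  have h2 : ∀ v, bwd (fwd v) = v := by
    intro v
    funext i
    have e : bwd (fwd v) i = ∑ j, (inner ℂ (g i) (g j) : ℂ) • v j := by
      simp [fwd, bwd]
    rw [e]
    simp [OrthonormalBasis.inner_eq_ite]
  let e : (Fin (Module.finrank ℂ G) → E) ≃L[ℂ] E ⊗[ℂ] G :=
    ContinuousLinearEquiv.equivOfInverse fwd bwd h2 h1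
  exact (completeSpace_congr (e := e.toEquiv) e.isUniformEmbedding).1 inferInstance

instance instFiniteDimensionalL2 {κ : Type*} [Finite κ] : FiniteDimensional ℂ (L2 κ) := by
  have := Fintype.ofFinite κ
  exact (lpPiLpₗᵢ (fun _ : κ => ℂ) ℂ (p := 2)).symm.toLinearEquiv.finiteDimensional

section Tensor

variable {E G : Type*} [NormedAddCommGroup E] [InnerProductSpace ℂ E]
  [NormedAddCommGroup G] [InnerProductSpace ℂ G]

/-- The map `ψ ↦ ψ ⊗ e` from `E` to `E ⊗ G`. -/
def tensorRight (e : G) : E →L[ℂ] E ⊗[ℂ] G := (TensorProduct.mkL ℂ E G).flip e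

/-- The partial trace over the second factor: the operator on `E` with
`⟨ψ, Tr₂(X) χ⟩ = ∑_S ⟨ψ ⊗ e_S, X (χ ⊗ e_S)⟩`, the vectors `e_S` being the canonical basis of the
second factor. -/
def partialTrace [CompleteSpace E] {κ : Type*} [Fintype κ] (X : Op (E ⊗[ℂ] L2 κ)) : Op E :=
  ∑ S : κ, (ContinuousLinearMap.adjoint (tensorRight (basisVec S))).comp
    (X.comp (tensorRight (basisVec S)))

end Tensor

/-! ### The reservoir -/

/-- The Fock space of the reservoir, over `ℓ²(ℤ)`. -/
abbrev FockR : Type := Fock ℤ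

/-- The shift `S Ψ_j = Ψ_{j-1}` on `ℓ²(ℤ)`. -/
def shift : L2 ℤ →ₗᵢ[ℂ] L2 ℤ :=
  ofOrthonormal (fun j : ℤ => basisVec (j - 1))
    (orthonormal_basisVec.comp _ (sub_left_injective))

/-- The C*-algebra `ℬ` generated by the operators `b(φ)`, `b^*(φ)`, `φ ∈ ℓ²(ℤ)`. -/
def resAlg : StarSubalgebra ℂ (Op FockR) :=
  (StarAlgebra.adjoin ℂ (Set.range (annih : L2 ℤ → Op FockR))).topologicalClosure

lemma annih_mem_resAlg (φ : L2 ℤ) : annih φ ∈ resAlg :=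
  StarSubalgebra.le_topologicalClosure _ (StarAlgebra.subset_adjoin ℂ _ ⟨φ, rfl⟩)

/-- `b(φ)`, as an element of `ℬ`. -/
def resAnnih (φ : L2 ℤ) : resAlg := ⟨annih φ, annih_mem_resAlg φ⟩

/-- `b^*(φ)`, as an element of `ℬ`. -/
def resCreate (φ : L2 ℤ) : resAlg := star (resAnnih φ)

/-- A state on `ℬ`: a positive normalized linear functional. -/
structure IsState (ω : resAlg →ₗ[ℂ] ℂ) : Prop where
  nonneg : ∀ B : resAlg, 0 ≤ ω (star B * B)
  map_one : ω 1 = 1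

/-- `ω` is gauge-invariant and quasi-free with density `D`:
`ω(b^*(φ_m) ⋯ b^*(φ_1) b(ψ_1) ⋯ b(ψ_n)) = δ_{nm} det (⟨ψ_j, D φ_k⟩)`. -/
structure IsQuasiFree (D : Op (L2 ℤ)) (ω : resAlg →ₗ[ℂ] ℂ) : Prop where
  eq_det : ∀ (n : ℕ) (φ ψ : Fin n → L2 ℤ),
    ω ((List.ofFn fun i => resCreate (φ i)).reverse.prod
        * (List.ofFn fun i => resAnnih (ψ i)).prod)
      = Matrix.det (Matrix.of fun j k => inner ℂ (ψ j) (D (φ k)))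
  eq_zero : ∀ (m n : ℕ) (φ : Fin m → L2 ℤ) (ψ : Fin n → L2 ℤ), m ≠ n →
    ω ((List.ofFn fun i => resCreate (φ i)).reverse.prod
        * (List.ofFn fun i => resAnnih (ψ i)).prod) = 0

lemma exists_linear_extension (ω : resAlg →ₗ[ℂ] ℂ) :
    ∃ g : Op FockR →ₗ[ℂ] ℂ, ∀ B : resAlg, g B = ω B := by
  obtain ⟨g, hg⟩ := LinearMap.exists_extend
    (p := Subalgebra.toSubmodule resAlg.toSubalgebra) (V' := ℂ) ω
  exact ⟨g, fun B => LinearMap.congr_fun hg B⟩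

/-- Some linear functional on the bounded operators which extends `ω`. It is only a device for
having total functions: it matters at elements of `ℬ` only, where it equals `ω`. -/
def linearExt (ω : resAlg →ₗ[ℂ] ℂ) : Op FockR →ₗ[ℂ] ℂ := (exists_linear_extension ω).choose

lemma linearExt_coe (ω : resAlg →ₗ[ℂ] ℂ) (B : resAlg) : linearExt ω B = ω B :=
  (exists_linear_extension ω).choose_spec B

/-! ### The sample and the coupled system -/

section Model

variable {d : ℕ}

/-- The Fock space of the sample, over `ℓ²({0, …, d-1})`. -/
abbrev FockS (d : ℕ) : Type := Fock (Fin d)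

/-- The Fock space of the composite system. -/
abbrev FockRS (d : ℕ) : Type := FockR ⊗[ℂ] FockS d

/-- Density matrices on the Fock space of the sample. -/
structure IsDensityMatrix (ρ : Op (FockS d)) : Prop where
  isPositive : ρ.IsPositive
  trace_eq_one : LinearMap.trace ℂ (FockS d) ρ.toLinearMap = 1

/-- The expectation `tr (ρ A)`. -/
def expect (ρ A : Op (FockS d)) : ℂ := LinearMap.trace ℂ (FockS d) (ρ * A).toLinearMap

/-- The product state `ω ⊗ ρ`: `X ↦ ω (Tr_s (X (1 ⊗ ρ)))`, where `Tr_s` is the partial trace over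
the sample. On the tensor product of `ℬ` and the observables of the sample, `Tr_s (X (1 ⊗ ρ))`
belongs to `ℬ`. -/
def productState (ω : resAlg →ₗ[ℂ] ℂ) (ρ : Op (FockS d)) (X : Op (FockRS d)) : ℂ :=
  linearExt ω (partialTrace (X * TensorProduct.mapL (1 : Op FockR) ρ))

/-- The one-body reduced density matrix of a functional `f` on the observables of the sample,
`⟨e_j, f⁽¹⁾ e_k⟩ = f (a_k^* a_j)`. -/
def oneBody (f : Op (FockS d) → ℂ) : Matrix (Fin d) (Fin d) ℂ :=
  Matrix.of fun j k => f (create (basisVec k) * annih (basisVec j))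

/-- The matrix `W_{jk} = ⟨e_j, W e_k⟩`. -/
def matrixOf (W : L2 (Fin d) ≃ₗᵢ[ℂ] L2 (Fin d)) : Matrix (Fin d) (Fin d) ℂ :=
  Matrix.of fun j k => inner ℂ (basisVec j) (W (basisVec k))

/-- The coupling `K = exp (-iα (b_0^* ⊗ a_0 + b_0 ⊗ a_0^*))`. -/
def coupling (d : ℕ) [NeZero d] (α : ℝ) : Op (FockRS d) :=
  NormedSpace.exp ((-(Complex.I * (α : ℂ))) •
    (TensorProduct.mapL (create (basisVec (0 : ℤ))) (annih (basisVec (0 : Fin d)))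
      + TensorProduct.mapL (annih (basisVec (0 : ℤ))) (create (basisVec (0 : Fin d)))))

variable [NeZero d]

/-- The one time step evolution `U = (Γ(S) ⊗ Γ(W)) K`. -/
def evolution (W : L2 (Fin d) ≃ₗᵢ[ℂ] L2 (Fin d)) (α : ℝ) : Op (FockRS d) :=
  TensorProduct.mapL (secondQuant shift) (secondQuant W.toLinearIsometry) * coupling d α

/-- The Heisenberg evolution `τ^t (X) = U^{*t} X U^t`. -/
def heisenberg (W : L2 (Fin d) ≃ₗᵢ[ℂ] L2 (Fin d)) (α : ℝ) (t : ℕ) (X : Op (FockRS d)) :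
    Op (FockRS d) :=
  (ContinuousLinearMap.adjoint (evolution W α)) ^ t * X * evolution W α ^ t

/-- The state of the sample at time `t`: `ρ_t (A) = (ω ⊗ ρ) (τ^t (1 ⊗ A))`. -/
def stateAt (W : L2 (Fin d) ≃ₗᵢ[ℂ] L2 (Fin d)) (α : ℝ) (ω : resAlg →ₗ[ℂ] ℂ)
    (ρ : Op (FockS d)) (t : ℕ) (A : Op (FockS d)) : ℂ :=
  productState ω ρ (heisenberg W α t (TensorProduct.mapL (1 : Op FockR) A))

/-- `𝕄 = W 𝒦`, where `𝒦 = 1 + (cos α - 1) |e_0⟩⟨e_0|`. -/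
def matM (W : L2 (Fin d) ≃ₗᵢ[ℂ] L2 (Fin d)) (α : ℝ) : Matrix (Fin d) (Fin d) ℂ :=
  matrixOf W * (1 + ((Real.cos α - 1 : ℝ) : ℂ) • Matrix.single 0 0 1)

/-- `𝔹 = W ℰ W^*`, where `ℰ = σ sin² α |e_0⟩⟨e_0|`. -/
def matB (W : L2 (Fin d) ≃ₗᵢ[ℂ] L2 (Fin d)) (α σ : ℝ) : Matrix (Fin d) (Fin d) ℂ :=
  matrixOf W * (((σ * Real.sin α ^ 2 : ℝ) : ℂ) • Matrix.single 0 0 1) * (matrixOf W)ᴴ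

/-- The superoperator `ℳ (A) = 𝕄 A 𝕄^*` on complex `d × d` matrices. -/
def superM (W : L2 (Fin d) ≃ₗᵢ[ℂ] L2 (Fin d)) (α : ℝ) :
    Module.End ℂ (Matrix (Fin d) (Fin d) ℂ) :=
  LinearMap.mulLeft ℂ (matM W α) * LinearMap.mulRight ℂ (matM W α)ᴴ

end Model

end FermiSample

end

/-!
The coupling `K` involves the site `0` of the reservoir only, and the shift brings a new site there
at each time step. In the state of density `σ` the sites are independent, so the sample undergoes
repeated interactions with fresh copies of a two-level system, and its reduced dynamics is the
iteration of a single map (`stateAt_eq_expect_iterate`). In the tensor product the operators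
`b_j ⊗ 1` and `1 ⊗ a_k` commute, hence `K` is not the exponential of a quadratic expression in a
common family of fermions, and `K^* (1 ⊗ a_k) K` is not linear in the field operators. The linear
recursion appears only once the reservoir is averaged out.

* `T = b_0^* ⊗ a_0 + b_0 ⊗ a_0^*` satisfies `T³ = T`, which gives `K = ∑_p P_p ⊗ C_p` with
  `P_p ∈ {1, b_0^* b_0, b_0^*, b_0}` (`coupling_eq_sum`).
* If `x` is a normal ordered word at the sites `k ≥ 1`, then
  `ω(P_p^* x P_q) = ω(x) ω(P_p^* P_q)` (`state_sandwich`). The determinant formula gives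
  `ω(r x) = ω(r) ω(x)` for `r` at the site `0`; moving `P_q` across `x` costs a sign, which matters
  only for words of odd length, and these have zero expectation. Together with the invariance of `ω`
  under the shift this is the Markov property (`productState_evolution`).
* The averaged coupling maps `a_m^* a_l` to a multiple of itself, plus a constant if `m = l = 0`
  (`reducedCoupling_quadratic`), and `Γ(W)` acts linearly on quadratic observables. Hence the
  one-body matrix `G_t` satisfies `G_{t+1} = ℳ(G_t) + 𝔹` (`oneBody_stateAt_succ`).
* Unitarity of `W` gives `(1 - ℳ)(σ 1) = 𝔹` (`one_sub_superM_smul_one`). As `‖𝕄‖ ≤ 1`, and an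
  eigenvalue of `𝕄` of modulus one would make `1` an eigenvalue of `ℳ`, the spectral radius of `𝕄`
  is less than one. By Gelfand's formula `𝕄^t → 0`, so that `ℳ^t → 0` (`tendsto_superM_pow`).
-/

noncomputable section

namespace FermiSample

/-! ### Fermionic Fock space: canonical anticommutation relations and second quantization -/

section Fock

variable {ι : Type*} [LinearOrder ι]

lemma hasSum_smul_basisVec {κ : Type*} (ψ : L2 κ) :
    HasSum (fun i => ψ i • (basisVec i : L2 κ)) ψ := by
  classical
  convert lp.hasSum_single (p := 2) (by simp) ψ using 2 with i
  ext j
  simp [basisVec_apply, lp.single_apply, Pi.single_apply]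

lemma op_ext_basisVec {κ E : Type*} [NormedAddCommGroup E] [NormedSpace ℂ E]
    {S T : L2 κ →L[ℂ] E} (h : ∀ i, S (basisVec i) = T (basisVec i)) : S = T := by
  ext ψ
  refine ((hasSum_smul_basisVec ψ).mapL S).unique ?_
  simpa [h] using (hasSum_smul_basisVec ψ).mapL T

lemma create_add (φ χ : L2 ι) : create (φ + χ) = create φ + create χ := by
  refine (hasSum_create _).unique ?_
  convert (hasSum_create φ).add (hasSum_create χ) using 2 with j
  rw [lp.coeFn_add, Pi.add_apply, add_smul]

lemma create_smul (c : ℂ) (φ : L2 ι) : create (c • φ) = c • create φ := by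
  refine (hasSum_create _).unique ?_
  convert (hasSum_create φ).const_smul c using 2 with j
  rw [lp.coeFn_smul, Pi.smul_apply, smul_eq_mul, mul_smul]

/-- The creation operator as a linear function of its one-particle vector. -/
def createLin : L2 ι →ₗ[ℂ] Op (Fock ι) where
  toFun := create
  map_add' := create_add
  map_smul' := create_smul

lemma create_basisVec (j : ι) : create (basisVec j) = siteCreate j := by
  classical
  refine (hasSum_create _).unique ?_
  convert hasSum_single j ?_ using 1
  · simp [basisVec_apply]
  · intro k hk
    simp [basisVec_apply, hk]

lemma site_anticomm (j k : ι) :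
    siteCreate j * siteCreate k + siteCreate k * siteCreate j = (0 : Op (Fock ι)) := by
  ext ψ S
  have hl : (siteCreate j * siteCreate k + siteCreate k * siteCreate j) ψ S
      = siteCreate j (siteCreate k ψ) S + siteCreate k (siteCreate j ψ) S := rfl
  rw [hl, siteCreate_apply, siteCreate_apply, siteCreate_apply, siteCreate_apply]
  by_cases hjk : j = k
  · subst hjk
    simp
  · have hkj : ¬ k = j := fun h => hjk h.symm
    by_cases hj : j ∈ S
    · by_cases hk : k ∈ S
      · rw [Finset.erase_right_comm (a := k) (b := j)]
        simp only [hj, hk, if_true, Finset.mem_erase, ne_eq, hjk, hkj, not_false_eq_true, and_self,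
          jwSign_erase S hj, jwSign_erase S hk]
        rcases lt_or_gt_of_ne hjk with h | h
        · simp [h, not_lt.2 h.le]; ring
        · simp [h, not_lt.2 h.le]; ring
      · simp [hj, hk]
    · simp [hj]

/-- The canonical anticommutation relation `{c^*(φ), c^*(χ)} = 0`. -/
lemma create_anticomm (φ χ : L2 ι) : create φ * create χ + create χ * create φ = 0 := by
  have h1 : ∀ j, siteCreate j * create χ + create χ * siteCreate j = 0 := by
    intro j
    have a := ((hasSum_create χ).mul_left (siteCreate j)).add
      ((hasSum_create χ).mul_right (siteCreate j))
    refine a.unique ?_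
    convert hasSum_zero using 2 with k
    rw [mul_smul_comm, smul_mul_assoc, ← smul_add, site_anticomm, smul_zero]
  have a := ((hasSum_create φ).mul_right (create χ)).add
    ((hasSum_create φ).mul_left (create χ))
  refine a.unique ?_
  convert hasSum_zero using 2 with k
  rw [mul_smul_comm, smul_mul_assoc, ← smul_add, h1, smul_zero]

lemma star_create (φ : L2 ι) : star (create φ) = annih φ := rfl

lemma star_annih (φ : L2 ι) : star (annih φ) = create φ := by
  rw [← star_create, star_star]

/-- The canonical anticommutation relation `{c(φ), c(χ)} = 0`. -/
lemma annih_anticomm (φ χ : L2 ι) : annih φ * annih χ + annih χ * annih φ = 0 := by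
  have h := congrArg star (create_anticomm χ φ)
  simpa [star_create] using h

lemma create_mul_self (φ : L2 ι) : create φ * create φ = 0 := by
  have h := create_anticomm φ φ
  rwa [← two_smul ℂ, smul_eq_zero_iff_right two_ne_zero] at h

lemma create_create_apply (φ χ : L2 ι) (x : Fock ι) :
    create φ (create χ x) = - create χ (create φ x) :=
  eq_neg_of_add_eq_zero_left (congrArg (fun T : Op (Fock ι) => T x) (create_anticomm φ χ))

/-- Inserting one vector into an ordered wedge product: up to a scalar which does not depend on the
vectors `f j`, the result is again an ordered wedge product. -/
lemma exists_wedge_cons (a : ι) (l : List ι) (hl : l.Pairwise (· < ·)) :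
    ∃ (c : ℂ) (l' : List ι), l'.Pairwise (· < ·) ∧ (∀ x ∈ l', x = a ∨ x ∈ l) ∧
      ∀ f : ι → L2 ι, wedge ((a :: l).map f) = c • wedge (l'.map f) := by
  induction l with
  | nil => exact ⟨1, [a], by simp, by simp, fun f => by simp⟩
  | cons b l ih =>
    rcases lt_trichotomy a b with h | rfl | h
    · refine ⟨1, a :: b :: l, ?_, by simp, fun f => by simp⟩
      rw [List.pairwise_cons]
      refine ⟨fun x hx => ?_, hl⟩
      rcases List.mem_cons.1 hx with rfl | hx
      · exact h
      · exact h.trans ((List.pairwise_cons.1 hl).1 x hx)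
    · refine ⟨0, [], by simp, by simp, fun f => ?_⟩
      rw [zero_smul]
      exact congrArg (fun T : Op (Fock ι) => T (wedge (l.map f))) (create_mul_self (f a))
    · rw [List.pairwise_cons] at hl
      obtain ⟨c, l', h1, h2, h3⟩ := ih hl.2
      refine ⟨-c, b :: l', ?_, ?_, fun f => ?_⟩
      · rw [List.pairwise_cons]
        refine ⟨fun x hx => ?_, h1⟩
        rcases h2 x hx with rfl | hx
        · exact h
        · exact hl.1 x hx
      · intro x hx
        rcases List.mem_cons.1 hx with rfl | hx
        · simp
        · rcases h2 x hx with rfl | hx <;> simp [*]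
      · have e : ∀ (a : ι) l, wedge ((a :: l).map f) = create (f a) (wedge (l.map f)) :=
          fun _ _ => rfl
        rw [e, e, create_create_apply, ← e a, h3, map_smul, e, neg_smul]

/-- Reordering a wedge product, with a scalar which does not depend on the vectors `f j`. -/
lemma exists_wedge_sort (l : List ι) :
    ∃ (c : ℂ) (S : Finset ι), ∀ f : ι → L2 ι,
      wedge (l.map f) = c • wedge ((S.sort (· ≤ ·)).map f) := by
  suffices h : ∃ (c : ℂ) (l' : List ι), l'.Pairwise (· < ·) ∧ ∀ f : ι → L2 ι,
      wedge (l.map f) = c • wedge (l'.map f) by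
    obtain ⟨c, l', h1, h2⟩ := h
    refine ⟨c, l'.toFinset, fun f => ?_⟩
    rw [h2, (List.toFinset_sort (· ≤ ·) h1.nodup).2 (h1.imp le_of_lt)]
  induction l with
  | nil => exact ⟨1, [], by simp, fun f => by simp⟩
  | cons a l ih =>
    obtain ⟨c, l', h1, h2⟩ := ih
    obtain ⟨c', l'', h1', -, h2'⟩ := exists_wedge_cons a l' h1
    refine ⟨c * c', l'', h1', fun f => ?_⟩
    have e : ∀ l, wedge ((a :: l).map f) = create (f a) (wedge (l.map f)) := fun _ => rfl
    rw [e, h2, map_smul, ← e, h2', smul_smul]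

lemma wedge_basisVec (l : List ι) (hl : l.Pairwise (· < ·)) :
    wedge (l.map basisVec) = basisVec l.toFinset := by
  induction l with
  | nil => rfl
  | cons a l ih =>
    rw [List.pairwise_cons] at hl
    have e : wedge ((a :: l).map basisVec) = create (basisVec a) (wedge (l.map basisVec)) := rfl
    rw [e, ih hl.2, create_basisVec]
    have ha : a ∉ l.toFinset := fun h => (hl.1 a (by simpa using h)).false
    ext T
    rw [siteCreate_apply, basisVec_apply, basisVec_apply, List.toFinset_cons]
    by_cases hT : T = insert a l.toFinset
    · subst hT
      have hs : (insert a l.toFinset).filter (· < a) = ∅ := by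
        refine Finset.filter_eq_empty_iff.2 fun x hx => ?_
        rcases Finset.mem_insert.1 hx with rfl | hx
        · exact lt_irrefl _
        · exact not_lt.2 (hl.1 x (by simpa using hx)).le
      simp [Finset.erase_insert ha, jwSign, hs]
    · rw [if_neg hT]
      split_ifs with h1 h2
      · exact absurd (by rw [← h2, Finset.insert_erase h1]) hT
      · simp
      · rfl

lemma wedge_sort_basisVec (S : Finset ι) :
    wedge ((S.sort (· ≤ ·)).map basisVec) = basisVec S := by
  rw [wedge_basisVec _ (Finset.sortedLT_sort S).pairwise, Finset.sort_toFinset]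

lemma secondQuant_wedge (u : L2 ι →ₗᵢ[ℂ] L2 ι) (l : List ι) :
    secondQuant u (wedge (l.map basisVec)) = wedge (l.map fun j => u (basisVec j)) := by
  obtain ⟨c, S, h⟩ := exists_wedge_sort l
  rw [h, h, map_smul, wedge_sort_basisVec]
  congr 1
  exact ofOrthonormal_basisVec _ (orthonormal_wedge (f := fun j => u (basisVec j))
    (orthonormal_basisVec.comp_linearIsometry u)) S

/-- The intertwining relation `Γ(u) c_j^* = c^*(u e_j) Γ(u)`. -/
lemma secondQuant_mul_create (u : L2 ι →ₗᵢ[ℂ] L2 ι) (j : ι) :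
    secondQuant u * create (basisVec j) = create (u (basisVec j)) * secondQuant u := by
  refine op_ext_basisVec fun S => ?_
  change secondQuant u (create (basisVec j) (basisVec S))
    = create (u (basisVec j)) (secondQuant u (basisVec S))
  rw [← wedge_sort_basisVec S, secondQuant_wedge]
  exact secondQuant_wedge u (j :: S.sort (· ≤ ·))

lemma star_secondQuant_mul_self (u : L2 ι →ₗᵢ[ℂ] L2 ι) :
    star (secondQuant u) * secondQuant u = 1 :=
  ContinuousLinearMap.ext fun x => ext_inner_left ℂ fun y => by
    change inner ℂ y (ContinuousLinearMap.adjoint (secondQuant u) (secondQuant u x)) = inner ℂ y x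
    rw [ContinuousLinearMap.adjoint_inner_right]
    exact LinearIsometry.inner_map_map _ y x

lemma star_secondQuant_create (u : L2 ι →ₗᵢ[ℂ] L2 ι) (j : ι) :
    star (secondQuant u) * create (u (basisVec j)) * secondQuant u = create (basisVec j) := by
  rw [mul_assoc, ← secondQuant_mul_create, ← mul_assoc, star_secondQuant_mul_self, one_mul]

lemma star_secondQuant_annih (u : L2 ι →ₗᵢ[ℂ] L2 ι) (j : ι) :
    star (secondQuant u) * annih (u (basisVec j)) * secondQuant u = annih (basisVec j) := by
  have h := congrArg star (star_secondQuant_create u j)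
  simpa [star_create, mul_assoc] using h

end Fock

/-- The second quantized shift is unitary. -/
lemma secondQuant_shift_mul_star : secondQuant shift * star (secondQuant shift) = 1 := by
  set v : L2 ℤ →ₗᵢ[ℂ] L2 ℤ := ofOrthonormal (fun j : ℤ => basisVec (j + 1))
    (orthonormal_basisVec.comp _ (add_left_injective 1)) with hv
  have h : secondQuant shift * secondQuant v = 1 := by
    refine op_ext_basisVec fun S => ?_
    change secondQuant shift (secondQuant v (basisVec S)) = basisVec S
    conv_lhs => rw [← wedge_sort_basisVec S]
    rw [secondQuant_wedge]
    have e : (fun j : ℤ => v (basisVec j)) = basisVec ∘ (fun j => j + 1) := by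
      funext j
      exact ofOrthonormal_basisVec _ _ j
    rw [e, ← List.map_map, secondQuant_wedge, List.map_map]
    have e' : (fun j : ℤ => shift (basisVec j)) ∘ (fun j => j + 1) = basisVec := by
      funext j
      refine (ofOrthonormal_basisVec _ _ (j + 1)).trans ?_
      simp
    rw [e', wedge_sort_basisVec]
  have h' : star (secondQuant shift) = secondQuant v := by
    rw [← mul_one (star _), ← h, ← mul_assoc, star_secondQuant_mul_self, one_mul]
  rw [h', h]

lemma shift_basisVec (j : ℤ) : shift (basisVec (j + 1)) = basisVec j := by
  refine (ofOrthonormal_basisVec _ _ (j + 1)).trans ?_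
  simp

/-! ### Partial trace and product states -/

section Tensor

variable {E : Type*} [NormedAddCommGroup E] [InnerProductSpace ℂ E] [CompleteSpace E]
  {κ : Type*} [Fintype κ]

lemma adjoint_tensorRight_tmul {G : Type*} [NormedAddCommGroup G] [InnerProductSpace ℂ G]
    [FiniteDimensional ℂ G] (e : G) (ψ : E) (χ : G) :
    ContinuousLinearMap.adjoint (tensorRight e) (ψ ⊗ₜ[ℂ] χ) = (inner ℂ e χ : ℂ) • ψ := by
  refine ext_inner_left ℂ fun y => ?_
  rw [ContinuousLinearMap.adjoint_inner_right, inner_smul_right]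
  change inner ℂ (y ⊗ₜ[ℂ] e) (ψ ⊗ₜ[ℂ] χ) = _
  rw [TensorProduct.inner_tmul, mul_comm]

lemma trace_eq_sum_basisVec (A : Op (L2 κ)) :
    LinearMap.trace ℂ (L2 κ) A.toLinearMap
      = ∑ S, (inner ℂ (basisVec S : L2 κ) (A (basisVec S)) : ℂ) := by
  have hsp : ⊤ ≤ Submodule.span ℂ (Set.range (basisVec : κ → L2 κ)) := by
    intro ψ _
    rw [(hasSum_smul_basisVec ψ).unique (hasSum_fintype _)]
    exact Submodule.sum_mem _ fun i _ => Submodule.smul_mem _ _ (Submodule.subset_span ⟨i, rfl⟩)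
  rw [LinearMap.trace_eq_sum_inner _ (OrthonormalBasis.mk orthonormal_basisVec hsp)]
  simp

lemma partialTrace_mapL (x : Op E) (A : Op (L2 κ)) :
    partialTrace (TensorProduct.mapL x A) = LinearMap.trace ℂ (L2 κ) A.toLinearMap • x := by
  rw [trace_eq_sum_basisVec, Finset.sum_smul]
  refine Finset.sum_congr rfl fun S _ => ?_
  ext ψ
  exact adjoint_tensorRight_tmul (basisVec S) (x ψ) (A (basisVec S))

end Tensor

lemma coe_resAnnih (φ : L2 ℤ) : (resAnnih φ : Op FockR) = annih φ := rfl

lemma coe_resCreate (φ : L2 ℤ) : (resCreate φ : Op FockR) = create φ :=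
  star_annih φ

section State

variable {d : ℕ}

/-- `X ↦ productState ω R X` as a linear map. -/
def productStateLin (ω : resAlg →ₗ[ℂ] ℂ) (R : Op (FockS d)) : Op (FockRS d) →ₗ[ℂ] ℂ where
  toFun := productState ω R
  map_add' X Y := by
    rw [productState, productState, productState, ← map_add]
    congr 1
    simp only [partialTrace, add_mul, ContinuousLinearMap.comp_add, ContinuousLinearMap.add_comp,
      Finset.sum_add_distrib]
  map_smul' c X := by
    rw [productState, productState, RingHom.id_apply, ← map_smul]
    congr 1
    simp only [partialTrace, smul_mul_assoc, ContinuousLinearMap.comp_smul,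
      ContinuousLinearMap.smul_comp, Finset.smul_sum]

lemma productStateLin_apply (ω : resAlg →ₗ[ℂ] ℂ) (R : Op (FockS d)) (X : Op (FockRS d)) :
    productStateLin ω R X = productState ω R X := rfl

lemma trace_mul_comm_op (A B : Op (FockS d)) :
    LinearMap.trace ℂ (FockS d) (A * B).toLinearMap
      = LinearMap.trace ℂ (FockS d) (B * A).toLinearMap :=
  LinearMap.trace_mul_comm ℂ A.toLinearMap B.toLinearMap

/-- On elementary tensors the product state is the product of the expectations. -/
lemma productStateLin_mapL (ω : resAlg →ₗ[ℂ] ℂ) (R : Op (FockS d)) (x : resAlg)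
    (A : Op (FockS d)) :
    productStateLin ω R (TensorProduct.mapL (x : Op FockR) A) = ω x * expect R A := by
  rw [productStateLin_apply, productState, ← TensorProduct.mapL_mul, mul_one, partialTrace_mapL,
    map_smul, linearExt_coe, smul_eq_mul, mul_comm, expect, trace_mul_comm_op]

end State

/-! ### Quasi-free expectations of normal ordered words -/

/-- `b_j`, as an element of `ℬ`. -/
def resB (j : ℤ) : resAlg := resAnnih (basisVec j)

/-- `b_j^*`, as an element of `ℬ`. -/
def resBs (j : ℤ) : resAlg := resCreate (basisVec j)

lemma star_resB (j : ℤ) : star (resB j) = resBs j := rfl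

lemma star_resBs (j : ℤ) : star (resBs j) = resB j := star_star _

lemma resB_anticomm (j k : ℤ) : resB j * resB k = -(resB k * resB j) :=
  Subtype.ext (eq_neg_of_add_eq_zero_left (annih_anticomm _ _))

lemma resBs_anticomm (j k : ℤ) : resBs j * resBs k = -(resBs k * resBs j) :=
  Subtype.ext (by
    change (resCreate _ : Op FockR) * (resCreate _ : Op FockR)
      = -((resCreate _ : Op FockR) * (resCreate _ : Op FockR))
    simp only [coe_resCreate]
    exact eq_neg_of_add_eq_zero_left (create_anticomm _ _))

lemma resB_resBs (j k : ℤ) :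
    resB j * resBs k + resBs k * resB j = if j = k then 1 else 0 := by
  apply Subtype.ext
  have h := car (basisVec j : L2 ℤ) (basisVec k)
  rw [inner_basisVec, basisVec_apply] at h
  change annih (basisVec j) * (resCreate _ : Op FockR)
      + (resCreate _ : Op FockR) * annih (basisVec j) = _
  rw [coe_resCreate, h]
  split_ifs <;> simp

lemma resB_sq (j : ℤ) : resB j * resB j = 0 := by
  have h := annih_anticomm (basisVec j : L2 ℤ) (basisVec j)
  rw [← two_smul ℂ, smul_eq_zero_iff_right two_ne_zero] at h
  exact Subtype.ext h

lemma resBs_sq (j : ℤ) : resBs j * resBs j = 0 := by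
  have h := congrArg star (resB_sq j)
  simpa [star_resB] using h

lemma resB_mul_resBs (j : ℤ) : resB j * resBs j = 1 - resBs j * resB j := by
  have h := resB_resBs j j
  rw [if_pos rfl] at h
  exact eq_sub_of_add_eq h

/-- The normal ordered word `b^*_{i_m} ⋯ b^*_{i_1} b_{j_1} ⋯ b_{j_n}`. -/
def word {m n : ℕ} (i : Fin m → ℤ) (j : Fin n → ℤ) : resAlg :=
  (List.ofFn fun a => resBs (i a)).reverse.prod * (List.ofFn fun a => resB (j a)).prod

lemma state_word_of_ne {ω : resAlg →ₗ[ℂ] ℂ} {D : Op (L2 ℤ)} (hω : IsQuasiFree D ω)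
    {m n : ℕ} (h : m ≠ n) (i : Fin m → ℤ) (j : Fin n → ℤ) : ω (word i j) = 0 :=
  hω.eq_zero m n _ _ h

/-- For the density `σ` the expectation of a normal ordered word in the `b_k^#` is `σ^n` times
the determinant of a matrix of Kronecker symbols. -/
lemma state_word {ω : resAlg →ₗ[ℂ] ℂ} {σ : ℂ} (hω : IsQuasiFree (σ • (1 : Op (L2 ℤ))) ω)
    {n : ℕ} (i j : Fin n → ℤ) :
    ω (word i j) = Matrix.det (Matrix.of fun a b => if j a = i b then σ else 0) := by
  refine (hω.eq_det n _ _).trans ?_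
  congr 1
  ext a b
  change inner ℂ (basisVec (j a)) (σ • (basisVec (i b) : L2 ℤ)) = _
  rw [inner_smul_right, inner_basisVec, basisVec_apply]
  simp

lemma state_word_shift {ω : resAlg →ₗ[ℂ] ℂ} {σ : ℂ} (hω : IsQuasiFree (σ • (1 : Op (L2 ℤ))) ω)
    {m n : ℕ} (i : Fin m → ℤ) (j : Fin n → ℤ) :
    ω (word (fun a => i a + 1) fun a => j a + 1) = ω (word i j) := by
  by_cases h : m = n
  · subst h
    simp [state_word hω]
  · rw [state_word_of_ne hω h, state_word_of_ne hω h]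

/-- A creation operator at a site without annihilation operators gives a column of zeros in the
determinant. -/
lemma state_word_cons_left {ω : resAlg →ₗ[ℂ] ℂ} {σ : ℂ}
    (hω : IsQuasiFree (σ • (1 : Op (L2 ℤ))) ω) {m n : ℕ} (i : Fin m → ℤ) (j : Fin n → ℤ) (k : ℤ)
    (hj : ∀ a, j a ≠ k) : ω (word (Fin.cons k i : Fin (m + 1) → ℤ) j) = 0 := by
  by_cases h : m + 1 = n
  · subst h
    rw [state_word hω]
    exact Matrix.det_eq_zero_of_column_eq_zero 0 fun a => by simp [hj a]
  · exact state_word_of_ne hω h _ _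

/-- An annihilation operator at a site without creation operators gives a row of zeros in the
determinant. -/
lemma state_word_cons_right {ω : resAlg →ₗ[ℂ] ℂ} {σ : ℂ}
    (hω : IsQuasiFree (σ • (1 : Op (L2 ℤ))) ω) {m n : ℕ} (i : Fin m → ℤ) (j : Fin n → ℤ) (k : ℤ)
    (hi : ∀ a, i a ≠ k) : ω (word i (Fin.cons k j : Fin (n + 1) → ℤ)) = 0 := by
  by_cases h : m = n + 1
  · subst h
    rw [state_word hω]
    exact Matrix.det_eq_zero_of_row_eq_zero 0 fun a => by simp [(hi a).symm]
  · exact state_word_of_ne hω h _ _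

/-- A pair `b_k^* b_k` at a new site contributes a factor `σ`, by expansion of the determinant along
its first row. -/
lemma state_word_cons_cons {ω : resAlg →ₗ[ℂ] ℂ} {σ : ℂ}
    (hω : IsQuasiFree (σ • (1 : Op (L2 ℤ))) ω) {m n : ℕ} (i : Fin m → ℤ) (j : Fin n → ℤ) (k : ℤ)
    (hi : ∀ a, i a ≠ k) :
    ω (word (Fin.cons k i : Fin (m + 1) → ℤ) (Fin.cons k j : Fin (n + 1) → ℤ))
      = σ * ω (word i j) := by
  by_cases h : m = n
  · subst h
    rw [state_word hω, state_word hω, Matrix.det_succ_row_zero, Fin.sum_univ_succ,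
      Finset.sum_eq_zero]
    · simp only [Fin.val_zero, pow_zero, one_mul, Matrix.of_apply, Fin.cons_zero, if_true,
        add_zero]
      congr 1
    · intro a _
      simp [(hi a).symm]
  · rw [state_word_of_ne hω h, state_word_of_ne hω (by omega), mul_zero]

lemma neg_one_pow_mul_self {A : Type*} [Ring A] (k : ℕ) : (-1 : A) ^ k * (-1) ^ k = 1 := by
  rcases neg_one_pow_eq_or A k with h | h <;> simp [h]

lemma mul_prod_of_anticomm {A : Type*} [Ring A] (b : A) (l : List A)
    (h : ∀ y ∈ l, b * y = -(y * b)) : b * l.prod = (-1) ^ l.length * (l.prod * b) := by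
  induction l with
  | nil => simp
  | cons y l ih =>
    rw [List.prod_cons, ← mul_assoc, h y (by simp), neg_mul, mul_assoc,
      ih fun z hz => h z (by simp [hz]), List.length_cons, pow_succ]
    simp only [← mul_assoc, (Commute.neg_one_right y).pow_right l.length |>.eq]
    simp

lemma resB_resBs_of_ne {j k : ℤ} (h : j ≠ k) : resB j * resBs k = -(resBs k * resB j) := by
  have := resB_resBs j k
  rw [if_neg h] at this
  exact eq_neg_of_add_eq_zero_left this

lemma resBs_resB_of_ne {j k : ℤ} (h : j ≠ k) : resBs j * resB k = -(resB k * resBs j) := by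
  rw [resB_resBs_of_ne h.symm, neg_neg]

section Site

variable {m n : ℕ} (i : Fin m → ℤ) (j : Fin n → ℤ)

lemma resBs_mul_word (k : ℤ) :
    resBs k * word i j = (-1) ^ m * word (Fin.cons k i : Fin (m + 1) → ℤ) j := by
  have h := mul_prod_of_anticomm (resBs k) (List.ofFn fun a => resBs (i a)).reverse (by
    intro y hy
    obtain ⟨a, rfl⟩ : ∃ a, resBs (i a) = y := by simpa using hy
    exact resBs_anticomm _ _)
  rw [word, ← mul_assoc, h, word, List.ofFn_succ, List.reverse_cons, List.prod_append]
  simp [mul_assoc]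

lemma resB_mul_word (k : ℤ) (hi : ∀ a, i a ≠ k) :
    resB k * word i j = (-1) ^ m * word i (Fin.cons k j : Fin (n + 1) → ℤ) := by
  have h := mul_prod_of_anticomm (resB k) (List.ofFn fun a => resBs (i a)).reverse (by
    intro y hy
    obtain ⟨a, rfl⟩ : ∃ a, resBs (i a) = y := by simpa using hy
    exact resB_resBs_of_ne (hi a).symm)
  rw [word, ← mul_assoc, h, word, List.ofFn_succ, List.prod_cons]
  simp [mul_assoc]

lemma number_mul_word (k : ℤ) (hi : ∀ a, i a ≠ k) :
    resBs k * resB k * word i j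
      = word (Fin.cons k i : Fin (m + 1) → ℤ) (Fin.cons k j : Fin (n + 1) → ℤ) := by
  rw [mul_assoc, resB_mul_word i j k hi, ← mul_assoc,
    ((Commute.neg_one_right (resBs k)).pow_right m).eq, mul_assoc, resBs_mul_word, ← mul_assoc,
    neg_one_pow_mul_self, one_mul]

lemma mul_word_of_anticomm (b : resAlg) (hb : ∀ a, b * resBs (i a) = -(resBs (i a) * b))
    (hb' : ∀ a, b * resB (j a) = -(resB (j a) * b)) :
    b * word i j = (-1) ^ (m + n) * (word i j * b) := by
  have h := mul_prod_of_anticomm b (List.ofFn fun a => resBs (i a)).reverse (by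
    intro y hy
    obtain ⟨a, rfl⟩ : ∃ a, resBs (i a) = y := by simpa using hy
    exact hb a)
  have h' := mul_prod_of_anticomm b (List.ofFn fun a => resB (j a)) (by
    intro y hy
    obtain ⟨a, rfl⟩ : ∃ a, resB (j a) = y := by simpa using hy
    exact hb' a)
  rw [word, ← mul_assoc, h, mul_assoc, mul_assoc, h', List.length_reverse, List.length_ofFn,
    List.length_ofFn, pow_add, mul_assoc, mul_assoc]
  congr 1
  rw [← mul_assoc, ((Commute.neg_one_right _).pow_right n).eq, mul_assoc]

end Site

/-- The span of `1, b_0^* b_0, b_0^*, b_0`. -/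
def siteSpan : Submodule ℂ resAlg :=
  Submodule.span ℂ {1, resBs 0 * resB 0, resBs 0, resB 0}

/-- The factors of the reservoir which occur in the coupling: `1, b_0^* b_0, b_0^*, b_0`. -/
def siteOp : Fin 4 → resAlg := ![1, resBs 0 * resB 0, resBs 0, resB 0]

lemma resB_mul_number : resB 0 * (resBs 0 * resB 0) = resB 0 := by
  rw [← mul_assoc, resB_mul_resBs, sub_mul, mul_assoc, resB_sq, one_mul, mul_zero, sub_zero]

lemma resBs_mul_number : resBs 0 * (resBs 0 * resB 0) = 0 := by
  rw [← mul_assoc, resBs_sq, zero_mul]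

lemma star_siteOp_mul_mem (p q : Fin 4) : star (siteOp p) * siteOp q ∈ siteSpan := by
  have h1 : (1 : resAlg) ∈ siteSpan := Submodule.subset_span (by simp)
  have hn : resBs 0 * resB 0 ∈ siteSpan := Submodule.subset_span (by simp)
  have hs : resBs 0 ∈ siteSpan := Submodule.subset_span (by simp)
  have hb : resB 0 ∈ siteSpan := Submodule.subset_span (by simp)
  have hB : ∀ x ∈ siteSpan, resB 0 * x ∈ siteSpan := by
    intro x hx
    induction hx using Submodule.span_induction with
    | mem x hx =>
      rcases hx with rfl | rfl | rfl | rfl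
      · rwa [mul_one]
      · rwa [resB_mul_number]
      · rw [resB_mul_resBs]
        exact sub_mem h1 hn
      · rw [resB_sq]
        exact zero_mem _
    | zero => rw [mul_zero]; exact zero_mem _
    | add x y _ _ hx hy => rw [mul_add]; exact add_mem hx hy
    | smul c x _ hx => rw [mul_smul_comm]; exact Submodule.smul_mem _ _ hx
  have hBs : ∀ x ∈ siteSpan, resBs 0 * x ∈ siteSpan := by
    intro x hx
    induction hx using Submodule.span_induction with
    | mem x hx =>
      rcases hx with rfl | rfl | rfl | rfl
      · rwa [mul_one]
      · rw [resBs_mul_number]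
        exact zero_mem _
      · rw [resBs_sq]
        exact zero_mem _
      · exact hn
    | zero => rw [mul_zero]; exact zero_mem _
    | add x y _ _ hx hy => rw [mul_add]; exact add_mem hx hy
    | smul c x _ hx => rw [mul_smul_comm]; exact Submodule.smul_mem _ _ hx
  have hq : siteOp q ∈ siteSpan := by
    fin_cases q <;> assumption
  fin_cases p
  · change star (1 : resAlg) * _ ∈ _
    rwa [star_one, one_mul]
  · change star (resBs 0 * resB 0) * _ ∈ _
    rw [star_mul, star_resB, star_resBs, mul_assoc]
    exact hBs _ (hB _ hq)
  · change star (resBs 0) * _ ∈ _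
    rw [star_resBs]
    exact hB _ hq
  · change star (resB 0) * _ ∈ _
    rw [star_resB]
    exact hBs _ hq

/-- The span of the normal ordered words in the `b_k^#`, `k ≥ 0`. -/
def halfLine : Submodule ℂ resAlg :=
  Submodule.span ℂ {x | ∃ (m n : ℕ) (i : Fin m → ℤ) (j : Fin n → ℤ),
    (∀ a, 0 ≤ i a) ∧ (∀ a, 0 ≤ j a) ∧ x = word i j}

section Factorization

variable {m n : ℕ} (i : Fin m → ℤ) (j : Fin n → ℤ)

lemma neg_one_pow_mul_mem {x : resAlg} (hx : x ∈ halfLine) (k : ℕ) : (-1) ^ k * x ∈ halfLine := by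
  rcases neg_one_pow_eq_or resAlg k with h | h <;> simp [h, hx]

/-- Multiplication by a monomial at the site `0` of a word at the sites `k ≥ 1` keeps it in the
span of the words at the sites `k ≥ 0`, and the state factorizes. -/
lemma siteSpan_mul_word {r : resAlg} (hr : r ∈ siteSpan) (hi : ∀ a, 0 < i a) (hj : ∀ a, 0 < j a) :
    r * word i j ∈ halfLine ∧
      ∀ {ω : resAlg →ₗ[ℂ] ℂ} {σ : ℂ}, IsQuasiFree (σ • (1 : Op (L2 ℤ))) ω → ω 1 = 1 →
        ω (r * word i j) = ω r * ω (word i j) := by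
  have hc : ∀ {m : ℕ} (i : Fin m → ℤ), (∀ a, 0 < i a) →
      ∀ a, 0 ≤ (Fin.cons 0 i : Fin (m + 1) → ℤ) a := by
    intro m i hi a
    refine Fin.cases ?_ (fun b => ?_) a
    · simp
    · simpa using (hi b).le
  have hi' : ∀ a, i a ≠ 0 := fun a => (hi a).ne'
  have hj' : ∀ a, j a ≠ 0 := fun a => (hj a).ne'
  -- the single letters at the site `0` as words, so that their expectations vanish as well
  have e1 : word (Fin.cons 0 Fin.elim0 : Fin 1 → ℤ) (Fin.elim0 : Fin 0 → ℤ) = resBs 0 := by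
    simp [word]
  have e2 : word (Fin.elim0 : Fin 0 → ℤ) (Fin.cons 0 Fin.elim0 : Fin 1 → ℤ) = resB 0 := by
    simp [word]
  induction hr using Submodule.span_induction with
  | mem x hx =>
    rcases hx with rfl | rfl | rfl | rfl
    · rw [one_mul]
      refine ⟨Submodule.subset_span ⟨m, n, i, j, fun a => (hi a).le, fun a => (hj a).le, rfl⟩, ?_⟩
      intro ω σ _ h1
      rw [h1, one_mul]
    · rw [number_mul_word i j 0 hi']
      refine ⟨Submodule.subset_span ⟨_, _, _, _, hc i hi, hc j hj, rfl⟩, ?_⟩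
      intro ω σ hω h1
      have h2 := number_mul_word (Fin.elim0 : Fin 0 → ℤ) (Fin.elim0 : Fin 0 → ℤ) 0 (by simp)
      have h3 : word (Fin.elim0 : Fin 0 → ℤ) (Fin.elim0 : Fin 0 → ℤ) = 1 := by simp [word]
      rw [h3, mul_one] at h2
      rw [h2, state_word_cons_cons hω i j 0 hi', state_word_cons_cons hω _ _ 0 (by simp), h3, h1,
        mul_one]
    · rw [resBs_mul_word]
      refine ⟨neg_one_pow_mul_mem
        (Submodule.subset_span ⟨_, _, _, _, hc i hi, fun a => (hj a).le, rfl⟩) m, ?_⟩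
      intro ω σ hω h1
      rw [← e1, state_word_of_ne hω (by simp), zero_mul]
      have := state_word_cons_left hω i j 0 hj'
      rcases neg_one_pow_eq_or resAlg m with h | h <;> simp [h, this]
    · rw [resB_mul_word i j 0 hi']
      refine ⟨neg_one_pow_mul_mem
        (Submodule.subset_span ⟨_, _, _, _, fun a => (hi a).le, hc j hj, rfl⟩) m, ?_⟩
      intro ω σ hω h1
      rw [← e2, state_word_of_ne hω (by simp), zero_mul]
      have := state_word_cons_right hω i j 0 hi'
      rcases neg_one_pow_eq_or resAlg m with h | h <;> simp [h, this]
  | zero => exact ⟨by simp, by intros; simp⟩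
  | add x y _ _ hx hy =>
    refine ⟨by rw [add_mul]; exact add_mem hx.1 hy.1, ?_⟩
    intro ω σ hω h1
    rw [add_mul, map_add, map_add, hx.2 hω h1, hy.2 hω h1, add_mul]
  | smul c x _ hx =>
    refine ⟨by rw [smul_mul_assoc]; exact Submodule.smul_mem _ _ hx.1, ?_⟩
    intro ω σ hω h1
    rw [smul_mul_assoc, map_smul, map_smul, hx.2 hω h1, smul_mul_assoc]

/-- A letter at the site `0` commutes with a word at the sites `k ≥ 1` up to a sign, and the sign
is `1` when the word has a nonzero expectation. -/
lemma word_mul_siteOp (q : Fin 4) (hi : ∀ a, 0 < i a) (hj : ∀ a, 0 < j a) :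
    ∃ k : ℕ, word i j * siteOp q = (-1) ^ k * (siteOp q * word i j) ∧
      ∀ {ω : resAlg →ₗ[ℂ] ℂ} {σ : ℂ}, IsQuasiFree (σ • (1 : Op (L2 ℤ))) ω →
        Even k ∨ ω (word i j) = 0 := by
  have hi' : ∀ a, i a ≠ 0 := fun a => (hi a).ne'
  have hj' : ∀ a, j a ≠ 0 := fun a => (hj a).ne'
  have hb := mul_word_of_anticomm i j (resB 0) (fun a => resB_resBs_of_ne (hi' a).symm)
    (fun a => resB_anticomm _ _)
  have hbs := mul_word_of_anticomm i j (resBs 0) (fun a => resBs_anticomm _ _)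
    (fun a => resBs_resB_of_ne (hj' a).symm)
  have hpar : ∀ {ω : resAlg →ₗ[ℂ] ℂ} {σ : ℂ}, IsQuasiFree (σ • (1 : Op (L2 ℤ))) ω →
      Even (m + n) ∨ ω (word i j) = 0 := by
    intro ω σ hω
    by_cases h : m = n
    · subst h
      exact Or.inl ⟨m, rfl⟩
    · exact Or.inr (state_word_of_ne hω h i j)
  fin_cases q
  · refine ⟨0, ?_, fun _ => Or.inl (by simp)⟩
    change word i j * 1 = (-1) ^ 0 * (1 * word i j)
    simp
  · refine ⟨0, ?_, fun _ => Or.inl (by simp)⟩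
    change word i j * (resBs 0 * resB 0) = (-1) ^ 0 * (resBs 0 * resB 0 * word i j)
    rw [pow_zero, one_mul, mul_assoc (resBs 0), hb]
    rcases neg_one_pow_eq_or resAlg (m + n) with h | h
    · rw [h, one_mul] at hbs ⊢
      rw [← mul_assoc (resBs 0), hbs, mul_assoc]
    · rw [h, neg_one_mul] at hbs ⊢
      rw [mul_neg, ← mul_assoc (resBs 0), hbs, neg_mul, neg_neg, mul_assoc]
  · refine ⟨m + n, ?_, hpar⟩
    change word i j * resBs 0 = (-1) ^ (m + n) * (resBs 0 * word i j)
    rw [hbs, ← mul_assoc, neg_one_pow_mul_self, one_mul]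
  · refine ⟨m + n, ?_, hpar⟩
    change word i j * resB 0 = (-1) ^ (m + n) * (resB 0 * word i j)
    rw [hb, ← mul_assoc, neg_one_pow_mul_self, one_mul]

lemma sandwich_mem (p q : Fin 4) (hi : ∀ a, 0 < i a) (hj : ∀ a, 0 < j a) :
    star (siteOp p) * word i j * siteOp q ∈ halfLine := by
  obtain ⟨k, hk, -⟩ := word_mul_siteOp i j q hi hj
  rw [mul_assoc, hk, ← mul_assoc, ((Commute.neg_one_right _).pow_right k).eq, mul_assoc,
    ← mul_assoc]
  exact neg_one_pow_mul_mem (siteSpan_mul_word i j (star_siteOp_mul_mem p q) hi hj).1 k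

/-- The factorization of the quasi-free state over the site `0` and the sites `k ≥ 1`. -/
lemma state_sandwich {ω : resAlg →ₗ[ℂ] ℂ} {σ : ℂ} (hω : IsQuasiFree (σ • (1 : Op (L2 ℤ))) ω)
    (h1 : ω 1 = 1) (p q : Fin 4) (hi : ∀ a, 0 < i a) (hj : ∀ a, 0 < j a) :
    ω (star (siteOp p) * word i j * siteOp q)
      = ω (word i j) * ω (star (siteOp p) * siteOp q) := by
  obtain ⟨k, hk, hk'⟩ := word_mul_siteOp i j q hi hj
  have h := (siteSpan_mul_word i j (star_siteOp_mul_mem p q) hi hj).2 hω h1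
  rw [mul_assoc, hk, ← mul_assoc, ((Commute.neg_one_right _).pow_right k).eq, mul_assoc,
    ← mul_assoc (star _)]
  rcases hk' hω with he | h0
  · rw [he.neg_one_pow, one_mul, h, mul_comm]
  · rcases neg_one_pow_eq_or resAlg k with hs | hs <;> simp [hs, h, h0]

end Factorization

section Shift

/-- Conjugation of a word by the second quantized shift moves it by one site. -/
lemma star_secondQuant_shift_word {m n : ℕ} (i : Fin m → ℤ) (j : Fin n → ℤ) :
    star (secondQuant shift) * (word i j : Op FockR) * secondQuant shift
      = (word (fun a => i a + 1) fun a => j a + 1 : resAlg) := by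
  set G := secondQuant shift
  have hm : ∀ X Y : Op FockR, star G * (X * Y) * G = (star G * X * G) * (star G * Y * G) := by
    intro X Y
    have : X * Y = X * (G * star G) * Y := by rw [secondQuant_shift_mul_star, mul_one]
    rw [this]
    simp only [mul_assoc]
  have hl : ∀ l l' : List resAlg,
      List.Forall₂ (fun x y : resAlg => star G * (x : Op FockR) * G = y) l l' →
      star G * ((l.prod : resAlg) : Op FockR) * G = (l'.prod : resAlg) := by
    intro l l' h
    induction h with
    | nil =>
      change star G * 1 * G = 1
      rw [mul_one, star_secondQuant_mul_self]
    | cons hx _ ih =>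
      rw [List.prod_cons, List.prod_cons]
      refine (hm _ _).trans ?_
      rw [hx, ih]
      rfl
  have hBs : ∀ k, star G * (resBs k : Op FockR) * G = (resBs (k + 1) : resAlg) := by
    intro k
    have := star_secondQuant_create shift (k + 1)
    rw [shift_basisVec] at this
    rw [resBs, resBs, coe_resCreate, coe_resCreate, this]
  have hB : ∀ k, star G * (resB k : Op FockR) * G = (resB (k + 1) : resAlg) := by
    intro k
    have := star_secondQuant_annih shift (k + 1)
    rw [shift_basisVec] at this
    exact this
  refine (hm _ _).trans ?_
  rw [hl _ (List.ofFn fun a => resBs (i a + 1)).reverse, hl _ (List.ofFn fun a => resB (j a + 1))]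
  · rfl
  · simp [List.forall₂_iff_get, hB]
  · rw [List.forall₂_reverse_iff]
    simp [List.forall₂_iff_get, hBs]

end Shift

/-! ### The coupling in closed form -/

/-- The exponential series of `z T` for an element with `T³ = T`. -/
lemma exp_smul_of_cube_eq {A : Type*} [NormedRing A] [NormedAlgebra ℂ A] [CompleteSpace A]
    {T : A} (hT : T ^ 3 = T) (z : ℂ) :
    NormedSpace.exp (z • T) = 1 + Complex.sinh z • T + (Complex.cosh z - 1) • T ^ 2 := by
  have hodd : ∀ k : ℕ, T ^ (2 * k + 1) = T := by
    intro k
    induction k with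
    | zero => simp
    | succ k ih =>
      rw [show 2 * (k + 1) + 1 = 2 * k + 1 + 2 by ring, pow_add, ih, ← pow_succ']
      exact hT
  have heven : ∀ k : ℕ, T ^ (2 * k) = T ^ 2 + if k = 0 then 1 - T ^ 2 else 0 := by
    intro k
    rcases k with _ | k
    · simp
    · rw [show 2 * (k + 1) = 2 * k + 1 + 1 by ring, pow_succ, hodd]
      simp [sq]
  refine (NormedSpace.exp_series_hasSum_exp' (𝕂 := ℂ) (z • T)).unique ?_
  have h1 : HasSum (fun k : ℕ => ((2 * k).factorial : ℂ)⁻¹ • (z • T) ^ (2 * k))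
      (Complex.cosh z • T ^ 2 + (1 - T ^ 2)) := by
    convert ((Complex.hasSum_cosh z).smul_const (T ^ 2)).add
      (hasSum_ite_eq (0 : ℕ) (1 - T ^ 2)) using 2 with k
    rw [smul_pow, heven, smul_smul, smul_add, div_eq_inv_mul]
    rcases k with _ | k <;> simp
  have h2 : HasSum (fun k : ℕ => ((2 * k + 1).factorial : ℂ)⁻¹ • (z • T) ^ (2 * k + 1))
      (Complex.sinh z • T) := by
    convert (Complex.hasSum_sinh z).smul_const T using 2 with k
    rw [smul_pow, hodd, smul_smul, div_eq_inv_mul]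
  convert HasSum.even_add_odd (f := fun n : ℕ => (n.factorial : ℂ)⁻¹ • (z • T) ^ n) h1 h2 using 1
  rw [sub_smul, one_smul]
  abel

section Sample

variable {d : ℕ} [NeZero d]

/-- `a_0`. -/
def smpA (d : ℕ) [NeZero d] : Op (FockS d) := annih (basisVec 0)

/-- `a_0^*`. -/
def smpAs (d : ℕ) [NeZero d] : Op (FockS d) := create (basisVec 0)

lemma star_smpA : star (smpA d) = smpAs d := star_annih _

lemma star_smpAs : star (smpAs d) = smpA d := star_create _

lemma smpA_sq : smpA d * smpA d = 0 := by
  rw [← star_smpAs, ← star_mul, smpAs, create_mul_self, star_zero]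

lemma smpAs_sq : smpAs d * smpAs d = 0 := create_mul_self _

lemma smpA_mul_smpAs : smpA d * smpAs d = 1 - smpAs d * smpA d := by
  have h := car (basisVec 0 : L2 (Fin d)) (basisVec 0)
  rw [inner_basisVec, basisVec_apply, if_pos rfl, one_smul] at h
  exact eq_sub_of_add_eq h

/-- The factors of the sample in the coupling. -/
def smpOp (d : ℕ) [NeZero d] (α : ℝ) : Fin 4 → Op (FockS d) :=
  ![1 + (Complex.cos α - 1) • (smpAs d * smpA d),
    (Complex.cos α - 1) • (1 - (2 : ℂ) • (smpAs d * smpA d)),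
    (-(Complex.I * Complex.sin α)) • smpA d,
    (-(Complex.I * Complex.sin α)) • smpAs d]

lemma mapL_sub_left {E G : Type*} [NormedAddCommGroup E] [InnerProductSpace ℂ E]
    [NormedAddCommGroup G] [InnerProductSpace ℂ G] (x y : Op E) (A : Op G) :
    TensorProduct.mapL (x - y) A = TensorProduct.mapL x A - TensorProduct.mapL y A :=
  eq_sub_of_add_eq (by rw [← TensorProduct.mapL_add_left, sub_add_cancel])

lemma mapL_sub_right {E G : Type*} [NormedAddCommGroup E] [InnerProductSpace ℂ E]
    [NormedAddCommGroup G] [InnerProductSpace ℂ G] (x : Op E) (A B : Op G) :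
    TensorProduct.mapL x (A - B) = TensorProduct.mapL x A - TensorProduct.mapL x B :=
  eq_sub_of_add_eq (by rw [← TensorProduct.mapL_add_right, sub_add_cancel])

lemma mapL_one_one {E G : Type*} [NormedAddCommGroup E] [InnerProductSpace ℂ E]
    [NormedAddCommGroup G] [InnerProductSpace ℂ G] :
    TensorProduct.mapL (1 : Op E) (1 : Op G) = 1 := TensorProduct.mapL_id_id

/-- The coupling in closed form, as a sum of four elementary tensors. -/
lemma coupling_eq_sum (α : ℝ) :
    coupling d α = ∑ p, TensorProduct.mapL (siteOp p : Op FockR) (smpOp d α p) := by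
  set b : Op FockR := ((resB 0 : resAlg) : Op FockR) with hb
  set bs : Op FockR := ((resBs 0 : resAlg) : Op FockR) with hbs
  set a := smpA d with ha
  set as := smpAs d with has
  have hbb : b * b = 0 := congrArg Subtype.val (resB_sq 0)
  have hbsbs : bs * bs = 0 := congrArg Subtype.val (resBs_sq 0)
  have hbbs : b * bs = 1 - bs * b := congrArg Subtype.val (resB_mul_resBs 0)
  have haa : a * a = 0 := smpA_sq
  have hasas : as * as = 0 := smpAs_sq
  have haas : a * as = 1 - as * a := smpA_mul_smpAs
  set T : Op (FockRS d) := TensorProduct.mapL bs a + TensorProduct.mapL b as with hT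
  have hT2 : T ^ 2 = TensorProduct.mapL (bs * b) (1 - as * a)
      + TensorProduct.mapL (1 - bs * b) (as * a) := by
    rw [sq, hT, add_mul, mul_add, mul_add]
    simp only [← TensorProduct.mapL_mul, hbb, hbsbs, hbbs, haas, haa, hasas,
      TensorProduct.mapL_zero_left]
    simp
  have e1 : bs * b * bs = bs := by
    rw [mul_assoc, hbbs, mul_sub, mul_one, ← mul_assoc, hbsbs, zero_mul, sub_zero]
  have e2 : bs * b * b = 0 := by rw [mul_assoc, hbb, mul_zero]
  have e3 : as * a * as = as := by
    rw [mul_assoc, haas, mul_sub, mul_one, ← mul_assoc, hasas, zero_mul, sub_zero]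
  have e4 : as * a * a = 0 := by rw [mul_assoc, haa, mul_zero]
  have hT3 : T ^ 3 = T := by
    rw [pow_succ, hT2, hT, add_mul, mul_add, mul_add]
    simp only [← TensorProduct.mapL_mul, sub_mul, one_mul, e1, e2, e3, e4, sub_zero, sub_self,
      TensorProduct.mapL_zero_right, add_zero, zero_add]
  have hc : coupling d α = NormedSpace.exp ((-(Complex.I * (α : ℂ))) • T) := by
    rw [hT, hb, hbs, ha, has, resB, resBs, coe_resCreate, coe_resAnnih]
    rfl
  have hcosh : Complex.cosh (-(Complex.I * (α : ℂ))) = Complex.cos α := by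
    rw [Complex.cosh_neg, mul_comm, Complex.cosh_mul_I]
  have hsinh : Complex.sinh (-(Complex.I * (α : ℂ))) = -(Complex.I * Complex.sin α) := by
    rw [Complex.sinh_neg, mul_comm, Complex.sinh_mul_I, mul_comm]
  rw [hc, exp_smul_of_cube_eq hT3, hcosh, hsinh, hT2, Fin.sum_univ_four]
  have hp : (siteOp 0 : Op FockR) = 1 ∧ (siteOp 1 : Op FockR) = bs * b ∧ (siteOp 2 : Op FockR) = bs
      ∧ (siteOp 3 : Op FockR) = b := ⟨rfl, rfl, rfl, rfl⟩
  rw [hp.1, hp.2.1, hp.2.2.1, hp.2.2.2]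
  simp only [smpOp, Matrix.cons_val]
  rw [← ha, ← has, hT]
  simp only [TensorProduct.mapL_smul_right, TensorProduct.mapL_add_right, mapL_sub_left,
    mapL_sub_right, mapL_one_one]
  module

end Sample

/-! ### The reduced dynamics of the sample is Markovian -/

section Sample

variable {d : ℕ}

/-- The span of the elementary tensors `x ⊗ A`, with `x` in the algebra of the sites `k ≥ 0`. -/
def halfLineTensor (d : ℕ) : Submodule ℂ (Op (FockRS d)) :=
  Submodule.span ℂ {X | ∃ x ∈ halfLine, ∃ A : Op (FockS d),
    X = TensorProduct.mapL (x : Op FockR) A}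

lemma mapL_mem_halfLineTensor {x : resAlg} (hx : x ∈ halfLine) (A : Op (FockS d)) :
    TensorProduct.mapL (x : Op FockR) A ∈ halfLineTensor d :=
  Submodule.subset_span ⟨x, hx, A, rfl⟩

/-- `A ↦ expect R A` as a linear map. -/
def expectLin (R : Op (FockS d)) : Op (FockS d) →ₗ[ℂ] ℂ where
  toFun := expect R
  map_add' A B := by
    rw [expect, mul_add, expect, expect, ← map_add]
    rfl
  map_smul' c A := by
    rw [expect, mul_smul_comm, expect, RingHom.id_apply, ← map_smul]
    rfl

variable [NeZero d]

lemma star_mapL {E G : Type*} [NormedAddCommGroup E] [InnerProductSpace ℂ E] [CompleteSpace E]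
    [NormedAddCommGroup G] [InnerProductSpace ℂ G] [FiniteDimensional ℂ G] [CompleteSpace G]
    (x : Op E) (A : Op G) :
    star (TensorProduct.mapL x A) = TensorProduct.mapL (star x) (star A) :=
  TensorProduct.adjoint_mapL x A

/-- The reduced action `A ↦ ∑_{p,q} ω(P_p^* P_q) C_p^* A C_q` on the observables of the sample of
the coupling `K = ∑_p P_p ⊗ C_p`. -/
def reducedCoupling (α : ℝ) (ω : resAlg →ₗ[ℂ] ℂ) (A : Op (FockS d)) : Op (FockS d) :=
  ∑ p, ∑ q, ω (star (siteOp p) * siteOp q) • (star (smpOp d α p) * A * smpOp d α q)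

/-- One time step of the sample in the Schrödinger picture. -/
def sampleStep (W : L2 (Fin d) ≃ₗᵢ[ℂ] L2 (Fin d)) (α : ℝ) (ω : resAlg →ₗ[ℂ] ℂ)
    (R : Op (FockS d)) : Op (FockS d) :=
  secondQuant W.toLinearIsometry * (∑ p, ∑ q, ω (star (siteOp p) * siteOp q) •
    (smpOp d α q * R * star (smpOp d α p))) * star (secondQuant W.toLinearIsometry)

lemma expect_sampleStep (W : L2 (Fin d) ≃ₗᵢ[ℂ] L2 (Fin d)) (α : ℝ) (ω : resAlg →ₗ[ℂ] ℂ)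
    (R A : Op (FockS d)) :
    expect (sampleStep W α ω R) A = expect R (reducedCoupling α ω
      (star (secondQuant W.toLinearIsometry) * A * secondQuant W.toLinearIsometry)) := by
  set G := secondQuant W.toLinearIsometry
  have h1 : expect (sampleStep W α ω R) A
      = expect (∑ p, ∑ q, ω (star (siteOp p) * siteOp q) •
        (smpOp d α q * R * star (smpOp d α p))) (star G * A * G) := by
    rw [expect, sampleStep, mul_assoc, mul_assoc, trace_mul_comm_op, expect]
    simp only [mul_assoc]
    rfl
  have h2 : ∀ (S : Op (FockS d)) B, expect S B = expectLin B S := fun S B => trace_mul_comm_op S B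
  have h3 : ∀ (S : Op (FockS d)) B, expect S B = expectLin S B := fun _ _ => rfl
  rw [h1, h2, h3, reducedCoupling]
  simp only [map_sum, map_smul]
  refine Finset.sum_congr rfl fun p _ => Finset.sum_congr rfl fun q _ => ?_
  congr 1
  rw [← h2, ← h3, expect, expect, mul_assoc, mul_assoc, trace_mul_comm_op]
  simp only [mul_assoc]

lemma star_evolution_word (W : L2 (Fin d) ≃ₗᵢ[ℂ] L2 (Fin d)) (α : ℝ) {m n : ℕ}
    (i : Fin m → ℤ) (j : Fin n → ℤ) (A : Op (FockS d)) :
    star (evolution W α) * TensorProduct.mapL (word i j : Op FockR) A * evolution W α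
      = ∑ p, ∑ q, TensorProduct.mapL
          ((star (siteOp p) * word (fun a => i a + 1) (fun a => j a + 1) * siteOp q : resAlg)
            : Op FockR)
          (star (smpOp d α p) * (star (secondQuant W.toLinearIsometry) * A
            * secondQuant W.toLinearIsometry) * smpOp d α q) := by
  have h : star (evolution W α) * TensorProduct.mapL (word i j : Op FockR) A * evolution W α
      = star (coupling d α) * TensorProduct.mapL
          (word (fun a => i a + 1) fun a => j a + 1 : resAlg)
          (star (secondQuant W.toLinearIsometry) * A * secondQuant W.toLinearIsometry)
          * coupling d α := by
    rw [evolution, star_mul, star_mapL, ← star_secondQuant_shift_word, TensorProduct.mapL_mul,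
      TensorProduct.mapL_mul]
    simp only [mul_assoc]
  rw [h, coupling_eq_sum, star_sum, Finset.sum_mul, Finset.sum_mul_sum]
  refine Finset.sum_congr rfl fun p _ => Finset.sum_congr rfl fun q _ => ?_
  rw [star_mapL, ← TensorProduct.mapL_mul, ← TensorProduct.mapL_mul]
  rfl

/-- One time step: the reduced dynamics of the sample is Markovian, because the site of the
reservoir which takes part in the coupling has not been visited before. -/
lemma productState_evolution (W : L2 (Fin d) ≃ₗᵢ[ℂ] L2 (Fin d)) (α : ℝ)
    {ω : resAlg →ₗ[ℂ] ℂ} {σ : ℂ} (hω : IsQuasiFree (σ • (1 : Op (L2 ℤ))) ω) (h1 : ω 1 = 1)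
    (R : Op (FockS d)) {X : Op (FockRS d)} (hX : X ∈ halfLineTensor d) :
    star (evolution W α) * X * evolution W α ∈ halfLineTensor d ∧
      productStateLin ω R (star (evolution W α) * X * evolution W α)
        = productStateLin ω (sampleStep W α ω R) X := by
  induction hX using Submodule.span_induction with
  | mem X hX =>
    obtain ⟨x, hx, A, rfl⟩ := hX
    induction hx using Submodule.span_induction with
    | mem x hx =>
      obtain ⟨m, n, i, j, hi, hj, rfl⟩ := hx
      have hi' : ∀ a, 0 < i a + 1 := fun a => by have := hi a; omega
      have hj' : ∀ a, 0 < j a + 1 := fun a => by have := hj a; omega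
      rw [star_evolution_word]
      refine ⟨Submodule.sum_mem _ fun p _ => Submodule.sum_mem _ fun q _ =>
        mapL_mem_halfLineTensor (sandwich_mem _ _ p q hi' hj') _, ?_⟩
      rw [productStateLin_mapL, expect_sampleStep, reducedCoupling]
      change _ = ω (word i j) * expectLin R _
      simp only [map_sum, map_smul, productStateLin_mapL, Finset.mul_sum]
      refine Finset.sum_congr rfl fun p _ => Finset.sum_congr rfl fun q _ => ?_
      rw [state_sandwich _ _ hω h1 p q hi' hj', state_word_shift hω, smul_eq_mul, mul_assoc]
      rfl
    | zero =>
      have : TensorProduct.mapL ((0 : resAlg) : Op FockR) A = 0 := TensorProduct.mapL_zero_left A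
      rw [this]
      simp
    | add x y _ _ hx hy =>
      have : TensorProduct.mapL ((x + y : resAlg) : Op FockR) A
        = TensorProduct.mapL (x : Op FockR) A + TensorProduct.mapL (y : Op FockR) A :=
        TensorProduct.mapL_add_left _ _ A
      rw [this, mul_add, add_mul, map_add, map_add, hx.2, hy.2]
      exact ⟨add_mem hx.1 hy.1, rfl⟩
    | smul c x _ hx =>
      have : TensorProduct.mapL ((c • x : resAlg) : Op FockR) A
        = c • TensorProduct.mapL (x : Op FockR) A := TensorProduct.mapL_smul_left c _ A
      rw [this, mul_smul_comm, smul_mul_assoc, map_smul, map_smul, hx.2]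
      exact ⟨Submodule.smul_mem _ _ hx.1, rfl⟩
  | zero => simp
  | add X Y _ _ hX hY =>
    rw [mul_add, add_mul, map_add, map_add, hX.2, hY.2]
    exact ⟨add_mem hX.1 hY.1, rfl⟩
  | smul c X _ hX =>
    rw [mul_smul_comm, smul_mul_assoc, map_smul, map_smul, hX.2]
    exact ⟨Submodule.smul_mem _ _ hX.1, rfl⟩

lemma heisenberg_succ (W : L2 (Fin d) ≃ₗᵢ[ℂ] L2 (Fin d)) (α : ℝ) (t : ℕ) (X : Op (FockRS d)) :
    heisenberg W α (t + 1) X = star (evolution W α) * heisenberg W α t X * evolution W α := by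
  rw [heisenberg, heisenberg, ContinuousLinearMap.star_eq_adjoint, pow_succ', pow_succ]
  simp only [mul_assoc]

/-- The state of the sample at time `t` is obtained by iteration of the one step map. -/
lemma stateAt_eq_expect_iterate (W : L2 (Fin d) ≃ₗᵢ[ℂ] L2 (Fin d)) (α : ℝ)
    {ω : resAlg →ₗ[ℂ] ℂ} {σ : ℂ} (hω : IsQuasiFree (σ • (1 : Op (L2 ℤ))) ω) (h1 : ω 1 = 1)
    (R : Op (FockS d)) (t : ℕ) (A : Op (FockS d)) :
    stateAt W α ω R t A = expect ((sampleStep W α ω)^[t] R) A := by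
  have h1' : (1 : resAlg) ∈ halfLine := Submodule.subset_span
    ⟨0, 0, Fin.elim0, Fin.elim0, by simp, by simp, by simp [word]⟩
  suffices h : ∀ t, heisenberg W α t (TensorProduct.mapL (1 : Op FockR) A) ∈ halfLineTensor d ∧
      ∀ R, productStateLin ω R (heisenberg W α t (TensorProduct.mapL (1 : Op FockR) A))
        = expect ((sampleStep W α ω)^[t] R) A from (h t).2 R
  intro t
  induction t with
  | zero =>
    have e : heisenberg W α 0 (TensorProduct.mapL (1 : Op FockR) A)
        = TensorProduct.mapL ((1 : resAlg) : Op FockR) A := by simp [heisenberg]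
    rw [e]
    refine ⟨mapL_mem_halfLineTensor h1' A, fun R => ?_⟩
    rw [productStateLin_mapL, h1, one_mul]
    rfl
  | succ t ih =>
    rw [heisenberg_succ]
    refine ⟨(productState_evolution W α hω h1 0 ih.1).1, fun R => ?_⟩
    rw [(productState_evolution W α hω h1 R ih.1).2, ih.2, Function.iterate_succ_apply]

end Sample

/-! ### The coupling on quadratic observables of the sample -/

/-- The expectations of the products of two factors of the coupling. -/
lemma state_star_siteOp_mul {ω : resAlg →ₗ[ℂ] ℂ} {σ : ℂ}
    (hω : IsQuasiFree (σ • (1 : Op (L2 ℤ))) ω) (h1 : ω 1 = 1) (p q : Fin 4) :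
    ω (star (siteOp p) * siteOp q)
      = !![1, σ, 0, 0; σ, σ, 0, 0; 0, 0, 1 - σ, 0; 0, 0, 0, σ] p q := by
  have e0 : word (Fin.elim0 : Fin 0 → ℤ) (Fin.elim0 : Fin 0 → ℤ) = 1 := by simp [word]
  have hb : ω (resB 0) = 0 := by
    have h := resB_mul_word (Fin.elim0 : Fin 0 → ℤ) (Fin.elim0 : Fin 0 → ℤ) 0 (by simp)
    rw [e0, mul_one, pow_zero, one_mul] at h
    rw [h, state_word_of_ne hω (by simp)]
  have hbs : ω (resBs 0) = 0 := by
    have h := resBs_mul_word (Fin.elim0 : Fin 0 → ℤ) (Fin.elim0 : Fin 0 → ℤ) 0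
    rw [e0, mul_one, pow_zero, one_mul] at h
    rw [h, state_word_of_ne hω (by simp)]
  have hn : ω (resBs 0 * resB 0) = σ := by
    have h := number_mul_word (Fin.elim0 : Fin 0 → ℤ) (Fin.elim0 : Fin 0 → ℤ) 0 (by simp)
    rw [e0, mul_one] at h
    rw [h, state_word_cons_cons hω _ _ 0 (by simp), e0, h1, mul_one]
  have hs : siteOp 0 = 1 ∧ siteOp 1 = resBs 0 * resB 0 ∧ siteOp 2 = resBs 0 ∧ siteOp 3 = resB 0 :=
    ⟨rfl, rfl, rfl, rfl⟩
  obtain ⟨h0, h2, h3, h4⟩ := hs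
  fin_cases p <;> fin_cases q <;>
    simp [h0, h2, h3, h4, star_resB, star_resBs, mul_assoc, resB_sq, resBs_sq, resB_mul_resBs,
      resB_mul_number, resBs_mul_number, mul_sub, hb, hbs, hn, h1]

section Sample

variable {d : ℕ} [NeZero d]

/-- The part of the coupling which preserves the occupation numbers, when the site `0` of the
reservoir is empty. -/
def emptyOp (d : ℕ) [NeZero d] (α : ℝ) : Op (FockS d) :=
  1 + (Complex.cos α - 1) • (smpAs d * smpA d)

/-- The part of the coupling which preserves the occupation numbers, when the site `0` of the
reservoir is occupied. -/
def fullOp (d : ℕ) [NeZero d] (α : ℝ) : Op (FockS d) :=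
  Complex.cos α • (1 : Op (FockS d)) + (1 - Complex.cos α) • (smpAs d * smpA d)

/-- The averaged coupling is a convex combination of the actions for an empty and for an occupied
site of the reservoir. -/
lemma reducedCoupling_eq (α : ℝ) {ω : resAlg →ₗ[ℂ] ℂ} {σ : ℂ}
    (hω : IsQuasiFree (σ • (1 : Op (L2 ℤ))) ω) (h1 : ω 1 = 1) (A : Op (FockS d)) :
    reducedCoupling α ω A
      = (1 - σ) • (emptyOp d α * A * emptyOp d α
          + Complex.sin α ^ 2 • (smpAs d * A * smpA d))
        + σ • (fullOp d α * A * fullOp d α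
          + Complex.sin α ^ 2 • (smpA d * A * smpAs d)) := by
  have hc : star (Complex.cos α) = Complex.cos α := by
    rw [← Complex.ofReal_cos]; exact Complex.conj_ofReal _
  have hs : star (Complex.sin α) = Complex.sin α := by
    rw [← Complex.ofReal_sin]; exact Complex.conj_ofReal _
  have hn : star (smpAs d * smpA d) = smpAs d * smpA d := by
    rw [star_mul, star_smpA, star_smpAs]
  have hI : star (-(Complex.I * Complex.sin α)) * -(Complex.I * Complex.sin α)
      = Complex.sin α ^ 2 := by
    rw [star_neg, star_mul, hs, Complex.star_def, Complex.conj_I]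
    linear_combination (-Complex.sin α ^ 2) * Complex.I_mul_I
  have h0 : star (smpOp d α 0) = emptyOp d α := by
    change star (1 + (Complex.cos α - 1) • (smpAs d * smpA d)) = _
    rw [star_add, star_smul, star_one, hn, star_sub, hc, star_one, emptyOp]
  have h2 : star (smpOp d α 1) = fullOp d α - emptyOp d α := by
    change star ((Complex.cos α - 1) • (1 - (2 : ℂ) • (smpAs d * smpA d))) = _
    rw [star_smul, star_sub, star_sub, star_smul, star_one, star_one, hc, hn, emptyOp, fullOp]
    simp only [star_ofNat]
    module
  have h3 : star (smpOp d α 2) * A * smpOp d α 2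
      = Complex.sin α ^ 2 • (smpAs d * A * smpA d) := by
    change star ((-(Complex.I * Complex.sin α)) • smpA d) * A
      * ((-(Complex.I * Complex.sin α)) • smpA d) = _
    rw [star_smul, star_smpA, smul_mul_assoc, smul_mul_smul_comm, hI]
  have h4 : star (smpOp d α 3) * A * smpOp d α 3
      = Complex.sin α ^ 2 • (smpA d * A * smpAs d) := by
    change star ((-(Complex.I * Complex.sin α)) • smpAs d) * A
      * ((-(Complex.I * Complex.sin α)) • smpAs d) = _
    rw [star_smul, star_smpAs, smul_mul_assoc, smul_mul_smul_comm, hI]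
  have h0' : smpOp d α 0 = emptyOp d α := rfl
  have h2' : smpOp d α 1 = fullOp d α - emptyOp d α := by
    change (Complex.cos α - 1) • (1 - (2 : ℂ) • (smpAs d * smpA d)) = _
    rw [emptyOp, fullOp]
    module
  rw [reducedCoupling]
  simp only [Fin.sum_univ_four, state_star_siteOp_mul hω h1, h0, h2, h3, h4, Matrix.of_apply,
    Matrix.cons_val, zero_smul, add_zero, zero_add, one_smul]
  rw [h0', h2']
  simp only [mul_sub, sub_mul]
  module

lemma number_mul_smpAs : smpAs d * smpA d * smpAs d = smpAs d := by
  rw [mul_assoc, smpA_mul_smpAs, mul_sub, ← mul_assoc, smpAs_sq, zero_mul, sub_zero, mul_one]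

lemma emptyOp_mul_smpAs (α : ℝ) : emptyOp d α * smpAs d = Complex.cos α • smpAs d := by
  rw [emptyOp, add_mul, smul_mul_assoc, number_mul_smpAs, one_mul]
  module

lemma smpAs_mul_emptyOp (α : ℝ) : smpAs d * emptyOp d α = smpAs d := by
  rw [emptyOp, mul_add, mul_smul_comm, ← mul_assoc, smpAs_sq]
  simp

lemma smpA_mul_number : smpA d * (smpAs d * smpA d) = smpA d := by
  rw [← mul_assoc, smpA_mul_smpAs, sub_mul, mul_assoc, smpA_sq]
  simp

lemma smpA_mul_emptyOp (α : ℝ) : smpA d * emptyOp d α = Complex.cos α • smpA d := by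
  rw [emptyOp, mul_add, mul_smul_comm, smpA_mul_number, mul_one]
  module

lemma emptyOp_mul_smpA (α : ℝ) : emptyOp d α * smpA d = smpA d := by
  rw [emptyOp, add_mul, smul_mul_assoc, mul_assoc, smpA_sq]
  simp

lemma fullOp_mul_smpAs (α : ℝ) : fullOp d α * smpAs d = smpAs d := by
  rw [fullOp, add_mul, smul_mul_assoc, smul_mul_assoc, number_mul_smpAs, one_mul]
  module

lemma smpAs_mul_fullOp (α : ℝ) : smpAs d * fullOp d α = Complex.cos α • smpAs d := by
  rw [fullOp, mul_add, mul_smul_comm, mul_smul_comm, ← mul_assoc, smpAs_sq]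
  simp

lemma smpA_mul_fullOp (α : ℝ) : smpA d * fullOp d α = smpA d := by
  rw [fullOp, mul_add, mul_smul_comm, mul_smul_comm, smpA_mul_number, mul_one]
  module

lemma fullOp_mul_smpA (α : ℝ) : fullOp d α * smpA d = Complex.cos α • smpA d := by
  rw [fullOp, add_mul, smul_mul_assoc, smul_mul_assoc, mul_assoc, smpA_sq]
  simp

lemma number_sq : smpAs d * smpA d * (smpAs d * smpA d) = smpAs d * smpA d := by
  rw [mul_assoc, smpA_mul_number]

lemma emptyOp_sq (α : ℝ) :
    emptyOp d α * emptyOp d α = 1 + (Complex.cos α ^ 2 - 1) • (smpAs d * smpA d) := by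
  rw [emptyOp, add_mul, mul_add, mul_add, smul_mul_smul_comm, number_sq, one_mul, one_mul, mul_one]
  module

lemma fullOp_sq (α : ℝ) : fullOp d α * fullOp d α
    = (Complex.cos α ^ 2) • (1 : Op (FockS d)) + (1 - Complex.cos α ^ 2) • (smpAs d * smpA d) := by
  rw [fullOp, add_mul, mul_add, mul_add, smul_mul_smul_comm, smul_mul_smul_comm,
    smul_mul_smul_comm, smul_mul_smul_comm, number_sq, one_mul, one_mul, mul_one]
  module

/-- The observables which commute with `a_0` and `a_0^*` are not affected. -/
lemma reducedCoupling_of_commute (α : ℝ) {ω : resAlg →ₗ[ℂ] ℂ} {σ : ℂ}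
    (hω : IsQuasiFree (σ • (1 : Op (L2 ℤ))) ω) (h1 : ω 1 = 1) (X : Op (FockS d))
    (hX : X * smpA d = smpA d * X)
    (hX' : X * smpAs d = smpAs d * X) : reducedCoupling α ω X = X := by
  have hn : X * (smpAs d * smpA d) = smpAs d * smpA d * X := by
    rw [← mul_assoc, hX', mul_assoc, hX, mul_assoc]
  have hC : emptyOp d α * X = X * emptyOp d α := by
    rw [emptyOp, add_mul, mul_add, smul_mul_assoc, mul_smul_comm, hn, one_mul, mul_one]
  have hD : fullOp d α * X = X * fullOp d α := by
    rw [fullOp, add_mul, mul_add, smul_mul_assoc, smul_mul_assoc, mul_smul_comm, mul_smul_comm, hn,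
      one_mul, mul_one]
  rw [reducedCoupling_eq α hω h1, hC, hD, ← hX, ← hX', mul_assoc, mul_assoc, mul_assoc, mul_assoc,
    emptyOp_sq, fullOp_sq, smpA_mul_smpAs, Complex.sin_sq]
  simp only [mul_add, mul_sub, mul_smul_comm, mul_one]
  module

lemma reducedCoupling_smpAs_mul (α : ℝ) {ω : resAlg →ₗ[ℂ] ℂ} {σ : ℂ}
    (hω : IsQuasiFree (σ • (1 : Op (L2 ℤ))) ω) (h1 : ω 1 = 1) (Y : Op (FockS d))
    (hY : smpA d * Y = -(Y * smpA d))
    (hY' : smpAs d * Y = -(Y * smpAs d)) :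
    reducedCoupling α ω (smpAs d * Y) = Complex.cos α • (smpAs d * Y) := by
  have hn : smpAs d * smpA d * Y = Y * (smpAs d * smpA d) := by
    rw [mul_assoc, hY, mul_neg, ← mul_assoc, hY', neg_mul, neg_neg, mul_assoc]
  have hC : Y * emptyOp d α = emptyOp d α * Y := by
    rw [emptyOp, add_mul, mul_add, smul_mul_assoc, mul_smul_comm, hn, one_mul, mul_one]
  have hD : Y * fullOp d α = fullOp d α * Y := by
    rw [fullOp, add_mul, mul_add, smul_mul_assoc, smul_mul_assoc, mul_smul_comm, mul_smul_comm, hn,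
      one_mul, mul_one]
  have e1 : emptyOp d α * (smpAs d * Y) * emptyOp d α = Complex.cos α • (smpAs d * Y) := by
    rw [← mul_assoc, emptyOp_mul_smpAs, mul_assoc, hC, ← mul_assoc, smul_mul_assoc,
      smpAs_mul_emptyOp, smul_mul_assoc]
  have e2 : fullOp d α * (smpAs d * Y) * fullOp d α = Complex.cos α • (smpAs d * Y) := by
    rw [← mul_assoc, fullOp_mul_smpAs, mul_assoc, hD, ← mul_assoc, smpAs_mul_fullOp,
      smul_mul_assoc]
  have e3 : smpAs d * (smpAs d * Y) * smpA d = 0 := by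
    rw [← mul_assoc, smpAs_sq, zero_mul, zero_mul]
  have e4 : smpA d * (smpAs d * Y) * smpAs d = 0 := by
    rw [hY', mul_neg, neg_mul, mul_assoc, mul_assoc, smpAs_sq, mul_zero, mul_zero, neg_zero]
  rw [reducedCoupling_eq α hω h1, e1, e2, e3, e4]
  module

lemma reducedCoupling_mul_smpA (α : ℝ) {ω : resAlg →ₗ[ℂ] ℂ} {σ : ℂ}
    (hω : IsQuasiFree (σ • (1 : Op (L2 ℤ))) ω) (h1 : ω 1 = 1) (Y : Op (FockS d))
    (hY : smpA d * Y = -(Y * smpA d))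
    (hY' : smpAs d * Y = -(Y * smpAs d)) :
    reducedCoupling α ω (Y * smpA d) = Complex.cos α • (Y * smpA d) := by
  have hn : smpAs d * smpA d * Y = Y * (smpAs d * smpA d) := by
    rw [mul_assoc, hY, mul_neg, ← mul_assoc, hY', neg_mul, neg_neg, mul_assoc]
  have hC : emptyOp d α * Y = Y * emptyOp d α := by
    rw [emptyOp, add_mul, mul_add, smul_mul_assoc, mul_smul_comm, hn, one_mul, mul_one]
  have hD : fullOp d α * Y = Y * fullOp d α := by
    rw [fullOp, add_mul, mul_add, smul_mul_assoc, smul_mul_assoc, mul_smul_comm, mul_smul_comm, hn,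
      one_mul, mul_one]
  have e1 : emptyOp d α * (Y * smpA d) * emptyOp d α = Complex.cos α • (Y * smpA d) := by
    rw [← mul_assoc, hC, mul_assoc Y, emptyOp_mul_smpA, mul_assoc, smpA_mul_emptyOp,
      mul_smul_comm]
  have e2 : fullOp d α * (Y * smpA d) * fullOp d α = Complex.cos α • (Y * smpA d) := by
    rw [← mul_assoc, hD, mul_assoc Y, fullOp_mul_smpA, mul_assoc, smul_mul_assoc,
      smpA_mul_fullOp, mul_smul_comm]
  have e3 : smpAs d * (Y * smpA d) * smpA d = 0 := by
    rw [mul_assoc, mul_assoc, smpA_sq, mul_zero, mul_zero]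
  have e4 : smpA d * (Y * smpA d) * smpAs d = 0 := by
    rw [← mul_assoc, hY, neg_mul, mul_assoc Y, smpA_sq, mul_zero, neg_zero, zero_mul]
  rw [reducedCoupling_eq α hω h1, e1, e2, e3, e4]
  module

lemma reducedCoupling_number (α : ℝ) {ω : resAlg →ₗ[ℂ] ℂ} {σ : ℂ}
    (hω : IsQuasiFree (σ • (1 : Op (L2 ℤ))) ω) (h1 : ω 1 = 1) :
    reducedCoupling α ω (smpAs d * smpA d)
      = (Complex.cos α ^ 2) • (smpAs d * smpA d) + (σ * Complex.sin α ^ 2) • 1 := by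
  have e1 : emptyOp d α * (smpAs d * smpA d) * emptyOp d α
      = (Complex.cos α ^ 2) • (smpAs d * smpA d) := by
    rw [← mul_assoc, emptyOp_mul_smpAs, mul_assoc, smpA_mul_emptyOp, smul_mul_smul_comm, sq]
  have e2 : fullOp d α * (smpAs d * smpA d) * fullOp d α = smpAs d * smpA d := by
    rw [← mul_assoc, fullOp_mul_smpAs, mul_assoc, smpA_mul_fullOp]
  have e3 : smpAs d * (smpAs d * smpA d) * smpA d = 0 := by
    rw [← mul_assoc, smpAs_sq, zero_mul, zero_mul]
  have e4 : smpA d * (smpAs d * smpA d) * smpAs d = 1 - smpAs d * smpA d := by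
    rw [smpA_mul_number, smpA_mul_smpAs]
  rw [reducedCoupling_eq α hω h1, e1, e2, e3, e4, Complex.sin_sq]
  module

/-- The reduced action on the quadratic observables `a_m^* a_l`. -/
lemma reducedCoupling_quadratic (α : ℝ) {ω : resAlg →ₗ[ℂ] ℂ} {σ : ℂ}
    (hω : IsQuasiFree (σ • (1 : Op (L2 ℤ))) ω) (h1 : ω 1 = 1) (m l : Fin d) :
    reducedCoupling α ω (create (basisVec m) * annih (basisVec l))
      = ((if m = 0 then Complex.cos α else 1) * if l = 0 then Complex.cos α else 1) •
          (create (basisVec m) * annih (basisVec l))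
        + (if m = 0 ∧ l = 0 then σ * Complex.sin α ^ 2 else 0) • (1 : Op (FockS d)) := by
  have hA : ∀ {l : Fin d}, l ≠ 0 → smpA d * annih (basisVec l) = -(annih (basisVec l) * smpA d) :=
    fun _ => eq_neg_of_add_eq_zero_left (annih_anticomm _ _)
  have hS : ∀ {l : Fin d}, l ≠ 0 →
      smpAs d * create (basisVec l) = -(create (basisVec l) * smpAs d) :=
    fun _ => eq_neg_of_add_eq_zero_left (create_anticomm _ _)
  have hA' : ∀ {l : Fin d}, l ≠ 0 →
      smpA d * create (basisVec l) = -(create (basisVec l) * smpA d) := by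
    intro l hl
    refine eq_neg_of_add_eq_zero_left ((car _ _).trans ?_)
    rw [inner_basisVec, basisVec_apply, if_neg hl.symm, zero_smul]
  have hS' : ∀ {l : Fin d}, l ≠ 0 →
      smpAs d * annih (basisVec l) = -(annih (basisVec l) * smpAs d) := by
    intro l hl
    refine eq_neg_of_add_eq_zero_right ((car _ _).trans ?_)
    rw [inner_basisVec, basisVec_apply, if_neg hl, zero_smul]
  have hA0 : annih (basisVec 0) = smpA d := rfl
  have hS0 : create (basisVec 0) = smpAs d := rfl
  by_cases hm : m = 0
  · subst hm
    by_cases hl : l = 0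
    · subst hl
      rw [hA0, hS0]
      simpa [sq] using reducedCoupling_number α hω h1
    · rw [hS0]
      simpa [hl] using reducedCoupling_smpAs_mul α hω h1 _ (hA hl) (hS' hl)
  · by_cases hl : l = 0
    · subst hl
      rw [hA0]
      simpa [hm] using reducedCoupling_mul_smpA α hω h1 _ (hA' hm) (hS hm)
    · rw [reducedCoupling_of_commute α hω h1]
      · simp [hm, hl]
      · rw [← mul_assoc, hA' hm, neg_mul, mul_assoc _ (smpA d), hA hl, mul_neg, neg_neg, mul_assoc]
      · rw [← mul_assoc, hS hm, neg_mul, mul_assoc _ (smpAs d), hS' hl, mul_neg, neg_neg, mul_assoc]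

end Sample

/-! ### The one-body reduced density matrix and its relaxation -/

section OneBody

variable {d : ℕ}

/-- In finite dimension the isometry `Γ(u)` is unitary. -/
lemma secondQuant_mul_star_self (u : L2 (Fin d) →ₗᵢ[ℂ] L2 (Fin d)) :
    secondQuant u * star (secondQuant u) = 1 := by
  have h : (star (secondQuant u)).toLinearMap * (secondQuant u).toLinearMap = 1 :=
    congrArg ContinuousLinearMap.toLinearMap (star_secondQuant_mul_self u)
  exact ContinuousLinearMap.coe_injective (mul_eq_one_comm.1 h)

lemma star_secondQuant_mul_create (W : L2 (Fin d) ≃ₗᵢ[ℂ] L2 (Fin d)) (k : Fin d) :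
    star (secondQuant W.toLinearIsometry) * create (basisVec k) * secondQuant W.toLinearIsometry
      = ∑ m, star (matrixOf W k m) • create (basisVec m) := by
  have h : (basisVec k : L2 (Fin d)) = ∑ m, star (matrixOf W k m) • W (basisVec m) := by
    conv_lhs => rw [← W.apply_symm_apply (basisVec k),
      (hasSum_smul_basisVec (W.symm (basisVec k))).unique (hasSum_fintype _), map_sum]
    refine Finset.sum_congr rfl fun m _ => ?_
    rw [map_smul]
    congr 1
    rw [← inner_basisVec, ← W.inner_map_map, W.apply_symm_apply]
    exact (inner_conj_symm _ _).symm
  have h' : create (basisVec k)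
      = ∑ m, star (matrixOf W k m) • create (W.toLinearIsometry (basisVec m)) := by
    have := congrArg createLin h
    rw [map_sum] at this
    simp only [map_smul] at this
    exact this
  rw [h', Finset.mul_sum, Finset.sum_mul]
  refine Finset.sum_congr rfl fun m _ => ?_
  rw [mul_smul_comm, smul_mul_assoc, star_secondQuant_create]

lemma star_secondQuant_mul_annih (W : L2 (Fin d) ≃ₗᵢ[ℂ] L2 (Fin d)) (j : Fin d) :
    star (secondQuant W.toLinearIsometry) * annih (basisVec j) * secondQuant W.toLinearIsometry
      = ∑ l, matrixOf W j l • annih (basisVec l) := by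
  have h := congrArg star (star_secondQuant_mul_create W j)
  simpa [star_create, mul_assoc] using h

/-- The action of `Γ(W)` on quadratic observables. -/
lemma star_secondQuant_mul_quadratic (W : L2 (Fin d) ≃ₗᵢ[ℂ] L2 (Fin d)) (k j : Fin d) :
    star (secondQuant W.toLinearIsometry) * (create (basisVec k) * annih (basisVec j))
        * secondQuant W.toLinearIsometry
      = ∑ m, ∑ l, (star (matrixOf W k m) * matrixOf W j l) •
          (create (basisVec m) * annih (basisVec l)) := by
  set G := secondQuant W.toLinearIsometry with hG
  have h : star G * (create (basisVec k) * annih (basisVec j)) * G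
      = (star G * create (basisVec k) * G) * (star G * annih (basisVec j) * G) := by
    have : create (basisVec k) * annih (basisVec j)
        = create (basisVec k) * (G * star G) * annih (basisVec j) := by
      rw [hG, secondQuant_mul_star_self, mul_one]
    rw [this]
    simp only [mul_assoc]
  rw [h, star_secondQuant_mul_create, star_secondQuant_mul_annih, Finset.sum_mul_sum]
  simp only [smul_mul_smul_comm]

variable [NeZero d]

lemma matM_apply (W : L2 (Fin d) ≃ₗᵢ[ℂ] L2 (Fin d)) (α : ℝ) (j l : Fin d) :
    matM W α j l = matrixOf W j l * if l = 0 then Complex.cos α else 1 := by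
  rw [matM, mul_add, mul_one, Matrix.add_apply, Matrix.mul_smul, Matrix.smul_apply]
  by_cases hl : l = 0
  · subst hl
    simp
    ring
  · simp [hl, Matrix.mul_single_apply_of_ne]

lemma matB_apply (W : L2 (Fin d) ≃ₗᵢ[ℂ] L2 (Fin d)) (α σ : ℝ) (j k : Fin d) :
    matB W α σ j k = matrixOf W j 0 * (σ * Complex.sin α ^ 2) * star (matrixOf W k 0) := by
  rw [matB, Matrix.mul_smul, Matrix.smul_mul, Matrix.smul_apply, Matrix.mul_apply,
    Finset.sum_eq_single 0]
  · simp
    ring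
  · intro b _ hb
    simp [Matrix.mul_single_apply_of_ne, hb]
  · simp

/-- One time step of the one-body reduced density matrix. -/
lemma oneBody_sampleStep (W : L2 (Fin d) ≃ₗᵢ[ℂ] L2 (Fin d)) (α σ : ℝ) {ω : resAlg →ₗ[ℂ] ℂ}
    (hω : IsQuasiFree ((σ : ℂ) • (1 : Op (L2 ℤ))) ω) (h1 : ω 1 = 1) (R : Op (FockS d))
    (hR : expect R 1 = 1) :
    oneBody (expect (sampleStep W α ω R)) = superM W α (oneBody (expect R)) + matB W α σ := by
  ext j k
  have hc : star (Complex.cos α) = Complex.cos α := by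
    rw [← Complex.ofReal_cos]; exact Complex.conj_ofReal _
  have hL : ∀ A : Op (FockS d), reducedCoupling α ω A
      = (∑ p, ∑ q, ω (star (siteOp p) * siteOp q) •
        (LinearMap.mulRight ℂ (smpOp d α q) ∘ₗ LinearMap.mulLeft ℂ (star (smpOp d α p)))) A := by
    intro A
    simp [reducedCoupling, LinearMap.sum_apply]
  have hE : ∀ A, expect R A = expectLin R A := fun _ => rfl
  change expect (sampleStep W α ω R) (create (basisVec k) * annih (basisVec j)) = _
  rw [expect_sampleStep, star_secondQuant_mul_quadratic, hL, hE]
  simp only [map_sum, map_smul]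
  rw [hE] at hR
  simp only [← hL, reducedCoupling_quadratic α hω h1, map_add, map_smul, hR]
  have hS : superM W α (oneBody (expect R)) j k
      = ∑ m, ∑ l, matM W α j l * expect R (create (basisVec m) * annih (basisVec l))
          * star (matM W α k m) := by
    change (matM W α * (oneBody (expect R) * (matM W α)ᴴ)) j k = _
    rw [← Matrix.mul_assoc, Matrix.mul_apply]
    refine Finset.sum_congr rfl fun m _ => ?_
    rw [Matrix.mul_apply, Finset.sum_mul]
    rfl
  have hB : matB W α σ j k = ∑ m, ∑ l, (star (matrixOf W k m) * matrixOf W j l) *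
      if m = 0 ∧ l = 0 then σ * Complex.sin α ^ 2 else 0 := by
    rw [matB_apply, Finset.sum_eq_single 0, Finset.sum_eq_single 0]
    · simp
      ring
    · intro b _ hb
      simp [hb]
    · simp
    · intro b _ hb
      simp [hb]
    · simp
  rw [Matrix.add_apply, hS, hB, ← Finset.sum_add_distrib]
  refine Finset.sum_congr rfl fun m _ => ?_
  rw [← Finset.sum_add_distrib]
  refine Finset.sum_congr rfl fun l _ => ?_
  rw [matM_apply, matM_apply, star_mul, apply_ite star, hc, star_one, hE]
  simp only [smul_eq_mul]
  ring

/-- The one step map of the sample preserves the trace. -/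
lemma expect_sampleStep_one (W : L2 (Fin d) ≃ₗᵢ[ℂ] L2 (Fin d)) (α : ℝ) {ω : resAlg →ₗ[ℂ] ℂ}
    {σ : ℂ} (hω : IsQuasiFree (σ • (1 : Op (L2 ℤ))) ω) (h1 : ω 1 = 1) (R : Op (FockS d)) :
    expect (sampleStep W α ω R) 1 = expect R 1 := by
  rw [expect_sampleStep, mul_one, star_secondQuant_mul_self,
    reducedCoupling_of_commute α hω h1 1 (by simp) (by simp)]

/-- The recursion for the one-body reduced density matrix. -/
lemma oneBody_stateAt_succ (W : L2 (Fin d) ≃ₗᵢ[ℂ] L2 (Fin d)) (α σ : ℝ) {ω : resAlg →ₗ[ℂ] ℂ}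
    (hω : IsQuasiFree ((σ : ℂ) • (1 : Op (L2 ℤ))) ω) (h1 : ω 1 = 1) (R : Op (FockS d))
    (hR : expect R 1 = 1) (t : ℕ) :
    oneBody (stateAt W α ω R (t + 1))
      = superM W α (oneBody (stateAt W α ω R t)) + matB W α σ := by
  have h : ∀ t, stateAt W α ω R t = expect ((sampleStep W α ω)^[t] R) :=
    fun t => funext (stateAt_eq_expect_iterate W α hω h1 R t)
  have ht : ∀ t, expect ((sampleStep W α ω)^[t] R) 1 = 1 := by
    intro t
    induction t with
    | zero => exact hR
    | succ t ih => rw [Function.iterate_succ_apply', expect_sampleStep_one W α hω h1, ih]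
  rw [h, h, Function.iterate_succ_apply', oneBody_sampleStep W α σ hω h1 _ (ht t)]

end OneBody

section Relaxation

open scoped Matrix.Norms.L2Operator

lemma tendsto_pow_of_spectralRadius_lt_one {A : Type*} [NormedRing A] [NormedAlgebra ℂ A]
    [CompleteSpace A] {a : A} (ha : spectralRadius ℂ a < 1) :
    Filter.Tendsto (fun t : ℕ => a ^ t) Filter.atTop (nhds 0) := by
  obtain ⟨r, hr, hr1⟩ := ENNReal.lt_iff_exists_nnreal_btwn.1 ha
  have hr1' : (r : ℝ) < 1 := by exact_mod_cast hr1
  rw [tendsto_zero_iff_norm_tendsto_zero]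
  refine squeeze_zero' (Filter.Eventually.of_forall fun _ => norm_nonneg _) ?_
    (tendsto_pow_atTop_nhds_zero_of_lt_one r.2 hr1')
  filter_upwards [(tendsto_order.1 (spectrum.pow_nnnorm_pow_one_div_tendsto_nhds_spectralRadius a)).2 r
    hr, Filter.eventually_ge_atTop 1] with n hn hn1
  have hn0 : (0 : ℝ) < n := by exact_mod_cast hn1
  have h := ENNReal.rpow_le_rpow hn.le hn0.le
  rw [← ENNReal.rpow_mul, one_div_mul_cancel hn0.ne', ENNReal.rpow_one, ENNReal.rpow_natCast] at h
  exact_mod_cast h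

variable {d : ℕ}

lemma matrixOf_mul_conjTranspose (W : L2 (Fin d) ≃ₗᵢ[ℂ] L2 (Fin d)) :
    matrixOf W * (matrixOf W)ᴴ = 1 := by
  have h : (matrixOf W)ᴴ * matrixOf W = 1 := by
    ext j k
    have hW : ∀ i, matrixOf W i j = W (basisVec j) i ∧ matrixOf W i k = W (basisVec k) i :=
      fun i => ⟨inner_basisVec _ _, inner_basisVec _ _⟩
    have h1 : (inner ℂ (W (basisVec j)) (W (basisVec k)) : ℂ)
        = ∑ i, inner ℂ (W (basisVec j) i) (W (basisVec k) i) :=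
      (lp.hasSum_inner (W (basisVec j)) (W (basisVec k))).unique (hasSum_fintype _)
    rw [W.inner_map_map, inner_basisVec, basisVec_apply] at h1
    rw [Matrix.mul_apply, Matrix.one_apply, h1]
    refine Finset.sum_congr rfl fun i _ => ?_
    rw [Matrix.conjTranspose_apply, (hW i).1, (hW i).2, RCLike.inner_apply, mul_comm]
    rfl
  exact mul_eq_one_comm.1 h

variable [NeZero d]

lemma norm_matM_le (W : L2 (Fin d) ≃ₗᵢ[ℂ] L2 (Fin d)) (α : ℝ) : ‖matM W α‖ ≤ 1 := by
  have hW : ‖matrixOf W‖ ≤ 1 := by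
    have h := CStarRing.norm_self_mul_star (x := matrixOf W)
    rw [Matrix.star_eq_conjTranspose, matrixOf_mul_conjTranspose, norm_one] at h
    nlinarith [norm_nonneg (matrixOf W)]
  have hD : (1 + ((Real.cos α - 1 : ℝ) : ℂ) • Matrix.single 0 0 1 : Matrix (Fin d) (Fin d) ℂ)
      = Matrix.diagonal fun i => if i = 0 then (Real.cos α : ℂ) else 1 := by
    ext i j
    by_cases hij : i = j
    · subst hij
      by_cases hi : i = 0
      · subst hi
        simp
      · simp [hi, Ne.symm hi]
    · have : ¬ (0 = i ∧ 0 = j) := fun h => hij (h.1.symm.trans h.2)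
      simp [hij, this]
  rw [matM, hD]
  refine (norm_mul_le _ _).trans (mul_le_one₀ hW (norm_nonneg _) ?_)
  rw [Matrix.l2_opNorm_diagonal, pi_norm_le_iff_of_nonneg zero_le_one]
  intro i
  split_ifs
  · rw [Complex.norm_real]
    exact Real.abs_cos_le_one α
  · simp

/-- An eigenvalue of `𝕄` on the unit circle makes `1` an eigenvalue of `ℳ`. -/
lemma one_mem_spectrum_superM (W : L2 (Fin d) ≃ₗᵢ[ℂ] L2 (Fin d)) (α : ℝ) {z : ℂ}
    (hz : z ∈ spectrum ℂ (matM W α)) (hz1 : ‖z‖ = 1) : (1 : ℂ) ∈ spectrum ℂ (superM W α) := by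
  rw [spectrum.mem_iff, Matrix.isUnit_iff_isUnit_det, isUnit_iff_ne_zero, not_not,
    ← Matrix.exists_mulVec_eq_zero_iff] at hz
  obtain ⟨v, hv, hv0⟩ := hz
  have hM : matM W α *ᵥ v = z • v := by
    rw [Matrix.sub_mulVec, sub_eq_zero, Algebra.algebraMap_eq_smul_one, Matrix.smul_mulVec,
      Matrix.one_mulVec] at hv0
    exact hv0.symm
  refine Module.End.HasEigenvalue.mem_spectrum (Module.End.hasEigenvalue_of_hasEigenvector
    (x := Matrix.vecMulVec v (star v)) ⟨Module.End.mem_eigenspace_iff.2 ?_, ?_⟩)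
  · change matM W α * (Matrix.vecMulVec v (star v) * (matM W α)ᴴ) = _
    rw [Matrix.vecMulVec_mul, ← Matrix.star_mulVec, hM, Matrix.mul_vecMulVec, hM, star_smul,
      Matrix.smul_vecMulVec, Matrix.vecMulVec_smul, smul_smul, Complex.star_def, Complex.mul_conj',
      hz1]
    simp
  · intro h0
    apply hv
    funext i
    have := congrFun (congrFun h0 i) i
    simpa [Matrix.vecMulVec_apply] using this

/-- Relaxation: the powers of `ℳ` tend to zero when its spectrum avoids the unit circle. -/
lemma tendsto_superM_pow (W : L2 (Fin d) ≃ₗᵢ[ℂ] L2 (Fin d)) (α : ℝ)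
    (hM : spectrum ℂ (superM W α) ∩ Metric.sphere (0 : ℂ) 1 = ∅) (A : Matrix (Fin d) (Fin d) ℂ) :
    Filter.Tendsto (fun t : ℕ => (superM W α ^ t) A) Filter.atTop (nhds 0) := by
  have hr : spectralRadius ℂ (matM W α) < 1 := by
    obtain ⟨z, hz, hzr⟩ := spectrum.exists_nnnorm_eq_spectralRadius (matM W α)
    have hz1 : ‖z‖ ≤ 1 := (spectrum.norm_le_norm_of_mem hz).trans (norm_matM_le W α)
    rw [← hzr]
    have hne : ‖z‖ ≠ 1 := fun h => by
      have : (1 : ℂ) ∈ spectrum ℂ (superM W α) ∩ Metric.sphere (0 : ℂ) 1 :=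
        ⟨one_mem_spectrum_superM W α hz h, by simp⟩
      rw [hM] at this
      exact this
    exact_mod_cast lt_of_le_of_ne hz1 hne
  have hp : ∀ t : ℕ, (superM W α ^ t) A = matM W α ^ t * A * (matM W α ^ t)ᴴ := by
    intro t
    induction t with
    | zero => simp
    | succ t ih =>
      rw [pow_succ', Module.End.mul_apply, ih]
      change matM W α * (matM W α ^ t * A * (matM W α ^ t)ᴴ * (matM W α)ᴴ) = _
      rw [pow_succ', Matrix.conjTranspose_mul]
      simp only [Matrix.mul_assoc]
  have h0 := tendsto_pow_of_spectralRadius_lt_one hr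
  have h := (h0.mul_const A).mul h0.star
  simp only [hp]
  simpa [Matrix.star_eq_conjTranspose] using h

/-- The fixed point equation for `σ 1`, which rests on the unitarity of `W` only. -/
lemma one_sub_superM_smul_one (W : L2 (Fin d) ≃ₗᵢ[ℂ] L2 (Fin d)) (α σ : ℝ) :
    (1 - superM W α) ((σ : ℂ) • (1 : Matrix (Fin d) (Fin d) ℂ)) = matB W α σ := by
  have hW := matrixOf_mul_conjTranspose W
  ext j k
  have hjk := congrFun (congrFun hW j) k
  have hc : star (Complex.cos α) = Complex.cos α := by
    rw [← Complex.ofReal_cos]; exact Complex.conj_ofReal _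
  have e : (superM W α ((σ : ℂ) • (1 : Matrix (Fin d) (Fin d) ℂ))) j k
      = σ * (matM W α * (matM W α)ᴴ) j k := by
    change (matM W α * (((σ : ℂ) • (1 : Matrix (Fin d) (Fin d) ℂ)) * (matM W α)ᴴ)) j k = _
    simp
  rw [LinearMap.sub_apply, Module.End.one_apply, Matrix.sub_apply, e, Matrix.smul_apply, ← hjk,
    smul_eq_mul, ← mul_sub, matB_apply, Matrix.mul_apply, Matrix.mul_apply,
    ← Finset.sum_sub_distrib, Finset.sum_eq_single 0]
  · rw [Matrix.conjTranspose_apply, Matrix.conjTranspose_apply, matM_apply, matM_apply, if_pos rfl,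
      star_mul, hc, Complex.sin_sq]
    ring
  · intro b _ hb
    simp [matM_apply, hb]
  · simp

end Relaxation

end FermiSample

end

theorem corollary44 (d : ℕ) [NeZero d] (α σ : ℝ) (hσ0 : 0 ≤ σ) (hσ1 : σ ≤ 1)
    (W : FermiSample.L2 (Fin d) ≃ₗᵢ[ℂ] FermiSample.L2 (Fin d))
    (ω : FermiSample.resAlg →ₗ[ℂ] ℂ) (hω : FermiSample.IsState ω)
    (hωσ : FermiSample.IsQuasiFree ((σ : ℂ) • (1 : FermiSample.Op (FermiSample.L2 ℤ))) ω)
    (ρ : FermiSample.Op (FermiSample.FockS d)) (hρ : FermiSample.IsDensityMatrix ρ)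
    (hM : spectrum ℂ (FermiSample.superM W α) ∩ Metric.sphere (0 : ℂ) 1 = ∅) :
    IsUnit (1 - FermiSample.superM W α) ∧
    (∀ t : ℕ, FermiSample.oneBody (FermiSample.stateAt W α ω ρ t) =
      (FermiSample.superM W α ^ t) (FermiSample.oneBody (FermiSample.expect ρ)
        - Ring.inverse (1 - FermiSample.superM W α) (FermiSample.matB W α σ))
      + Ring.inverse (1 - FermiSample.superM W α) (FermiSample.matB W α σ)) ∧
    Filter.Tendsto (fun t : ℕ => FermiSample.oneBody (FermiSample.stateAt W α ω ρ t))
      Filter.atTop (nhds (Ring.inverse (1 - FermiSample.superM W α) (FermiSample.matB W α σ))) ∧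
    Ring.inverse (1 - FermiSample.superM W α) (FermiSample.matB W α σ)
      = (σ : ℂ) • (1 : Matrix (Fin d) (Fin d) ℂ) := by
  have hunit : IsUnit (1 - FermiSample.superM W α) := by
    have h1 : (1 : ℂ) ∉ spectrum ℂ (FermiSample.superM W α) := fun h => by
      have : (1 : ℂ) ∈ spectrum ℂ (FermiSample.superM W α) ∩ Metric.sphere (0 : ℂ) 1 :=
        ⟨h, by simp⟩
      rw [hM] at this
      exact this
    simpa using spectrum.notMem_iff.1 h1
  have hfix := FermiSample.one_sub_superM_smul_one W α σ
  have hinv : Ring.inverse (1 - FermiSample.superM W α) (FermiSample.matB W α σ)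
      = (σ : ℂ) • (1 : Matrix (Fin d) (Fin d) ℂ) := by
    rw [← hfix, ← Module.End.mul_apply, Ring.inverse_mul_cancel _ hunit, Module.End.one_apply]
  have htr : FermiSample.expect ρ 1 = 1 := by
    rw [FermiSample.expect, mul_one]
    exact hρ.trace_eq_one
  have hB : FermiSample.matB W α σ = (σ : ℂ) • (1 : Matrix (Fin d) (Fin d) ℂ)
      - FermiSample.superM W α ((σ : ℂ) • (1 : Matrix (Fin d) (Fin d) ℂ)) := hfix.symm
  have hform : ∀ t : ℕ, FermiSample.oneBody (FermiSample.stateAt W α ω ρ t) =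
      (FermiSample.superM W α ^ t) (FermiSample.oneBody (FermiSample.expect ρ)
        - (σ : ℂ) • (1 : Matrix (Fin d) (Fin d) ℂ))
      + (σ : ℂ) • (1 : Matrix (Fin d) (Fin d) ℂ) := by
    intro t
    induction t with
    | zero =>
      have : FermiSample.stateAt W α ω ρ 0 = FermiSample.expect ρ :=
        funext (FermiSample.stateAt_eq_expect_iterate W α hωσ hω.map_one ρ 0)
      rw [this]
      simp
    | succ t ih =>
      rw [FermiSample.oneBody_stateAt_succ W α σ hωσ hω.map_one ρ htr, ih, map_add, hB, pow_succ',
        Module.End.mul_apply]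
      abel
  rw [hinv]
  refine ⟨hunit, hform, ?_, rfl⟩
  rw [funext hform]
  have h := (FermiSample.tendsto_superM_pow W α hM (FermiSample.oneBody (FermiSample.expect ρ)
    - (σ : ℂ) • (1 : Matrix (Fin d) (Fin d) ℂ))).add_const
    ((σ : ℂ) • (1 : Matrix (Fin d) (Fin d) ℂ))
  rw [zero_add] at h
  exact h
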